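/- Let $S_1^3$ be the de Sitter space in the upper half-space model $\{x_3>0\}$ with the metric $\frac{1}{x_3^2}(dx_1^2+dx_2^2-dx_3^2)$, regarded as a Lie group with product $a\cdot y=(a_1+a_3y_1,\,a_2+a_3y_2,\,a_3y_3)$ and identity $e=(0,0,1)$. Let $x$ be a time-like immersed surface in $S_1^3$ with smooth space-like unit normal field $N=x_3\sum_A\eta_A\,\partial/\partial x_A$. Its normal Gauss map is $\widetilde N=L_{x^{-1}*}N=\sum_A\eta_A\,\partial/\partial x_A(e)$. It is called conformal if the fourth fundamental form $\mathrm{IV}=\langle d\widetilde N,d\widetilde N\rangle$ (Lorentz-Minkowski scalar product, signature $(+,+,-)$) satisfies $\mathrm{IV}=\rho\,\mathrm{II}$ for some smooth function $\rho$, where $\mathrm{II}$ is the second fundamental form. **Theorem.** Let $U\subset\mathbb R^2$ be open and connected and let $f:U\to(0,\infty)$ be smooth, of the form $f(u,v)=\phi(u)+\psi(v)$, with time-like graph $(u,v,f(u,v))$ in $S_1^3$ (that is, $f_u^2+f_v^2>1$). Assume that the graph is nontrivial, i.e. not part of a plane: $f$ is not of the form $\alpha u+\beta v+\gamma$ on $U$.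 Then the normal Gauss map of the graph is conformal if and only if, up to a translation of the variables $u$ and $v$ and possibly an interchange of them, one of the following holds, where $a,b$ are nonzero constants and the quantities under the roots are positive on $U$: (1) $f(u,v)=\sqrt{u^2+a^2}\pm\sqrt{v^2+b^2}$ on $U$; (2) $f(u,v)=\sqrt{u^2-a^2}\pm\sqrt{v^2-b^2}$ on $U$; (3) $f(u,v)=\sqrt{u^2+a^2}\pm\sqrt{v^2-b^2}$ on $U$; (4) $f(u,v)=\sqrt{u^2-a^2}-\sqrt{v^2+b^2}$ on $U$; (5) the graph is a Flaherty surface: on every open rectangle $I\times J\subset U$ ($I,J$ nonempty open intervals, possibly unbounded), $f(u,v)=\pm u+\psi(v)$, or $f(u,v)=\pm v+\psi(u)$, with a smooth function $\psi$ whose derivative vanishes nowhere. (The choice of the form, the sign and $\psi$ may depend on the rectangle; if $U$ is itself such a rectangle, one form holds on all of $U$.) -/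

import Mathlib

open scoped ContDiff

noncomputable section

namespace DeSitter

/-- The Lorentz metric `(dx₁² + dx₂² - dx₃²) / x₃²` of the upper half-space model of the
de Sitter space `S₁³`, as the matrix of its components at `p`. The coordinates `x₁, x₂, x₃` are
`p 0, p 1, p 2`, and the model is the half-space `0 < p 2`. -/
def metric (p : Fin 3 → ℝ) : Matrix (Fin 3) (Fin 3) ℝ :=
  Matrix.diagonal ![1 / p 2 ^ 2, 1 / p 2 ^ 2, -(1 / p 2 ^ 2)]

/-- The scalar product of two tangent vectors of `S₁³` at `p`. -/
def metricInner (p X Y : Fin 3 → ℝ) : ℝ := ∑ A, ∑ B, metric p A B * X A * Y B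

/-- The Lorentz-Minkowski scalar product on the tangent space at the identity `(0, 0, 1)`. -/
def minkowski (X Y : Fin 3 → ℝ) : ℝ := X 0 * Y 0 + X 1 * Y 1 - X 2 * Y 2

/-- The derivative of the metric component `g_AB` in the direction of the coordinate `C`. -/
def metricDeriv (p : Fin 3 → ℝ) (C A B : Fin 3) : ℝ :=
  fderiv ℝ (fun q => metric q A B) p (Pi.single C 1)

/-- The Christoffel symbol `Γ^C_AB` of the Levi-Civita connection of the metric. -/
def christoffel (p : Fin 3 → ℝ) (C A B : Fin 3) : ℝ :=
  1 / 2 * ∑ D, (metric p)⁻¹ C D *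
    (metricDeriv p A D B + metricDeriv p B D A - metricDeriv p D A B)

/-- The multiplication of the Lie group carried by the half-space:
`a · y = (a₁ + a₃ y₁, a₂ + a₃ y₂, a₃ y₃)`, with identity `(0, 0, 1)`. -/
def groupMul (a y : Fin 3 → ℝ) : Fin 3 → ℝ :=
  ![a 0 + a 2 * y 0, a 1 + a 2 * y 1, a 2 * y 2]

/-- The inverse in this group. -/
def groupInv (a : Fin 3 → ℝ) : Fin 3 → ℝ :=
  ![-(a 0 / a 2), -(a 1 / a 2), (a 2)⁻¹]

/-- The induced metric (first fundamental form) of `x` at the parameter `p`. -/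
def firstForm (x : ℝ × ℝ → Fin 3 → ℝ) (p X Y : ℝ × ℝ) : ℝ :=
  metricInner (x p) (fderiv ℝ x p X) (fderiv ℝ x p Y)

/-- `x` is time-like on `U`: its induced metric is nondegenerate of signature `(1, 1)`,
that is, has a negative determinant. In particular `x` is an immersion. -/
def IsTimelike (U : Set (ℝ × ℝ)) (x : ℝ × ℝ → Fin 3 → ℝ) : Prop :=
  ∀ p ∈ U, firstForm x p (1, 0) (1, 0) * firstForm x p (0, 1) (0, 1)
    - firstForm x p (1, 0) (0, 1) ^ 2 < 0

/-- A smooth space-like unit normal field along `x`, by its components in `∂/∂x_A`. -/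
structure IsUnitNormal (U : Set (ℝ × ℝ)) (x N : ℝ × ℝ → Fin 3 → ℝ) : Prop where
  smooth : ContDiffOn ℝ ∞ N U
  unit : ∀ p ∈ U, metricInner (x p) (N p) (N p) = 1
  normal : ∀ p ∈ U, ∀ X, metricInner (x p) (N p) (fderiv ℝ x p X) = 0

/-- The covariant derivative `∇_X (dx Y)` along `x`, for constant vector fields `X`, `Y` on the
parameter domain. -/
def covDeriv (x : ℝ × ℝ → Fin 3 → ℝ) (p X Y : ℝ × ℝ) : Fin 3 → ℝ := fun C =>
  fderiv ℝ (fun q => fderiv ℝ x q Y) p X C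
    + ∑ A, ∑ B, christoffel (x p) C A B * fderiv ℝ x p X A * fderiv ℝ x p Y B

/-- The second fundamental form of `x` with respect to the normal field `N`. -/
def secondForm (x N : ℝ × ℝ → Fin 3 → ℝ) (p X Y : ℝ × ℝ) : ℝ :=
  metricInner (x p) (covDeriv x p X Y) (N p)

/-- The normal Gauss map: the unit normal is translated to the identity by the differential of
the left translation by the inverse of `x p`. -/
def normalGaussMap (x N : ℝ × ℝ → Fin 3 → ℝ) (p : ℝ × ℝ) : Fin 3 → ℝ :=
  fderiv ℝ (groupMul (groupInv (x p))) (x p) (N p)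

/-- The fourth fundamental form `⟨dÑ, dÑ⟩` of `x`, where `Ñ` is the normal Gauss map. -/
def fourthForm (x N : ℝ × ℝ → Fin 3 → ℝ) (p X Y : ℝ × ℝ) : ℝ :=
  minkowski (fderiv ℝ (normalGaussMap x N) p X) (fderiv ℝ (normalGaussMap x N) p Y)

/-- The normal Gauss map of `x` is conformal: the fourth fundamental form is `ρ` times the second
one, for a smooth function `ρ`. This does not depend on the choice of the unit normal. -/
def HasConformalNormalGaussMap (U : Set (ℝ × ℝ)) (x : ℝ × ℝ → Fin 3 → ℝ) : Prop :=
  ∃ N : ℝ × ℝ → Fin 3 → ℝ, IsUnitNormal U x N ∧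
    ∃ ρ : ℝ × ℝ → ℝ, ContDiffOn ℝ ∞ ρ U ∧
      ∀ p ∈ U, ∀ X Y, fourthForm x N p X Y = ρ p * secondForm x N p X Y

/-- The graph `(u, v, f (u, v))`. -/
def graph (f : ℝ × ℝ → ℝ) (p : ℝ × ℝ) : Fin 3 → ℝ := ![p.1, p.2, f p]

/-- On `U`, after a translation of the variables, `f` is one of
(1) `√(u² + a²) ± √(v² + b²)`, (2) `√(u² - a²) ± √(v² - b²)`,
(3) `√(u² + a²) ± √(v² - b²)`, (4) `√(u² - a²) - √(v² + b²)`, with `a, b ≠ 0` and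
positive radicands. -/
def IsRadicalSum (U : Set (ℝ × ℝ)) (f : ℝ × ℝ → ℝ) : Prop :=
  ∃ a b u₀ v₀ ε : ℝ, a ≠ 0 ∧ b ≠ 0 ∧ (ε = 1 ∨ ε = -1) ∧
    ((∀ p ∈ U, f p = √((p.1 - u₀) ^ 2 + a ^ 2) + ε * √((p.2 - v₀) ^ 2 + b ^ 2)) ∨
     (∀ p ∈ U, a ^ 2 < (p.1 - u₀) ^ 2 ∧ b ^ 2 < (p.2 - v₀) ^ 2 ∧
        f p = √((p.1 - u₀) ^ 2 - a ^ 2) + ε * √((p.2 - v₀) ^ 2 - b ^ 2)) ∨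
     (∀ p ∈ U, b ^ 2 < (p.2 - v₀) ^ 2 ∧
        f p = √((p.1 - u₀) ^ 2 + a ^ 2) + ε * √((p.2 - v₀) ^ 2 - b ^ 2)) ∨
     (∀ p ∈ U, a ^ 2 < (p.1 - u₀) ^ 2 ∧
        f p = √((p.1 - u₀) ^ 2 - a ^ 2) - √((p.2 - v₀) ^ 2 + b ^ 2)))

/-- `f` is a Flaherty graph `± u + ψ v` over the rectangle `I ×ˢ J`, with `ψ' ≠ 0`. -/
def IsFlaherty (I J : Set ℝ) (f : ℝ × ℝ → ℝ) : Prop :=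
  ∃ (ε : ℝ) (ψ : ℝ → ℝ), (ε = 1 ∨ ε = -1) ∧ ContDiffOn ℝ ∞ ψ J ∧
    (∀ v ∈ J, deriv ψ v ≠ 0) ∧ ∀ u ∈ I, ∀ v ∈ J, f (u, v) = ε * u + ψ v

end DeSitter

end

namespace DeSitter

open Filter Topology

/-! ### The de Sitter space -/

/-! Put `W = φ'² + ψ'² - 1`, which is positive on a time-like graph. The normal Gauss map is `k (φ',
ψ', 1)` with `k² W = 1`. Hence `W² IV = W (φ''² du² + ψ''² dv²) - (φ' φ'' du + ψ' ψ'' dv)²`, while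
`II` is a multiple of `f (φ'' du² + ψ'' dv²) + (φ' du + ψ' dv)² - du² - dv²`. Where `φ' ψ' ≠ 0`, the
mixed coefficient fixes the factor of proportionality, and the diagonal ones become `φ'' E = ψ'' E =
0` with `E = φ'' (ψ'² - 1) + ψ'' (φ'² - 1) + f φ'' ψ''`. A continuity argument covers the zeros of
`φ' ψ'` (`defect_eq_zero_or`); conversely `E = 0` gives conformality (`conformal_of_defect`).

As `f = φ + ψ`, for every constant `c` one has `E = φ'' ((ψ + c) ψ'' + ψ'² - 1) + ψ'' ((φ - c) φ'' +
φ'² - 1)`. If `φ'' ψ'' ≠ 0` at some point, a suitable `c` makes both brackets vanish nearby. Then `y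
= φ - c` and `y = ψ + c` satisfy `y y'' + y'² = 1`, that is `(y²)'' = 2`, so `y²` is a shifted
square plus a nonzero constant. This spreads over the connected set `U` (`exists_sq_eq`), and `f >
0` excludes two negative roots.

If `φ'' ψ'' = 0` everywhere, `E = 0` says that `φ'' ≠ 0` forces `ψ' = ±1` and `ψ'' ≠ 0` forces `φ' =
±1`. On a rectangle this leaves a Flaherty graph or two constant slopes different from `±1`; the
latter make the whole graph a plane (`isFlaherty_or`, `eq_affine`). -/

lemma metricInner_eq (p X Y : Fin 3 → ℝ) :
    metricInner p X Y = minkowski X Y / p 2 ^ 2 := by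
  simp [metricInner, metric, minkowski, Fin.sum_univ_three, Matrix.diagonal_apply]
  ring

lemma metricDeriv_eq {p : Fin 3 → ℝ} (hp : p 2 ≠ 0) (C A B : Fin 3) :
    metricDeriv p C A B =
      (if C = 2 then -2 / p 2 ^ 3 else 0) * Matrix.diagonal ![(1 : ℝ), 1, -1] A B := by
  have h1 : (fun q : Fin 3 → ℝ => metric q A B) =
      fun q => (q 2 ^ 2)⁻¹ * Matrix.diagonal ![(1 : ℝ), 1, -1] A B := by
    funext q
    fin_cases A <;> fin_cases B <;> simp [metric]
  have h2 : HasFDerivAt (fun q : Fin 3 → ℝ => q 2)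
      (ContinuousLinearMap.proj (R := ℝ) (φ := fun _ : Fin 3 => ℝ) 2) p :=
    hasFDerivAt_apply 2 p
  have h3 := ((hasDerivAt_inv (pow_ne_zero 2 hp)).comp_hasFDerivAt p (h2.pow 2)).mul_const
    (Matrix.diagonal ![(1 : ℝ), 1, -1] A B)
  rw [metricDeriv, h1]
  erw [h3.fderiv]
  by_cases hC : C = 2
  · subst hC
    simp
    field_simp
  · simp [hC, Ne.symm hC]

lemma metric_inv {p : Fin 3 → ℝ} (hp : p 2 ≠ 0) :
    (metric p)⁻¹ = Matrix.diagonal ![p 2 ^ 2, p 2 ^ 2, -p 2 ^ 2] := by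
  apply Matrix.inv_eq_right_inv
  rw [metric, Matrix.diagonal_mul_diagonal, ← Matrix.diagonal_one]
  congr 1
  funext i
  fin_cases i <;> simp [hp]

lemma sum_christoffel {p : Fin 3 → ℝ} (hp : p 2 ≠ 0) (C : Fin 3) (X Y : Fin 3 → ℝ) :
    ∑ A, ∑ B, christoffel p C A B * X A * Y B =
      ![-(X 0 * Y 2 + X 2 * Y 0) / p 2, -(X 1 * Y 2 + X 2 * Y 1) / p 2,
        -(X 0 * Y 0 + X 1 * Y 1 + X 2 * Y 2) / p 2] C := by
  simp only [christoffel, metric_inv hp, metricDeriv_eq hp, Fin.sum_univ_three]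
  fin_cases C <;> simp <;> field_simp <;> ring

/-- Left translations are affine, and their linear part is a homothety. -/
lemma normalGaussMap_eq (x N : ℝ × ℝ → Fin 3 → ℝ) (p : ℝ × ℝ) :
    normalGaussMap x N p = (x p 2)⁻¹ • N p := by
  have h : groupMul (groupInv (x p)) =
      fun y => ![groupInv (x p) 0, groupInv (x p) 1, 0] + (x p 2)⁻¹ • y := by
    funext y i
    fin_cases i <;> simp [groupMul, groupInv]
  have h2 := ((hasFDerivAt_id (𝕜 := ℝ) (x p)).const_smul (x p 2)⁻¹).const_add
    ![groupInv (x p) 0, groupInv (x p) 1, 0]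
  rw [normalGaussMap, h]
  erw [h2.fderiv]
  simp

/-! ### Graphs of translation type -/

variable {U : Set (ℝ × ℝ)} {f : ℝ × ℝ → ℝ} {φ ψ : ℝ → ℝ}

/-- `f` is the sum of a smooth function of the first variable and one of the second. -/
structure IsTranslation (U : Set (ℝ × ℝ)) (f : ℝ × ℝ → ℝ) (φ ψ : ℝ → ℝ) : Prop where
  isOpen : IsOpen U
  smooth_fst : ContDiffOn ℝ ∞ φ (Prod.fst '' U)
  smooth_snd : ContDiffOn ℝ ∞ ψ (Prod.snd '' U)
  eq : ∀ p ∈ U, f p = φ p.1 + ψ p.2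

/-- Along a slice of `U` each summand differs from `f` by a constant, so it inherits the smoothness
of `f`. -/
lemma IsTranslation.of_contDiffOn (hUo : IsOpen U) (hf : ContDiffOn ℝ ∞ f U)
    (h : ∀ p ∈ U, f p = φ p.1 + ψ p.2) : IsTranslation U f φ ψ := by
  refine ⟨hUo, ?_, ?_, h⟩
  · rintro _ ⟨p, hp, rfl⟩
    have h1 : ContDiffAt ℝ ∞ (fun u => f (u, p.2) - ψ p.2) p.1 := by
      have := hf.contDiffAt (hUo.mem_nhds hp)
      exact (ContDiffAt.comp (f := fun u : ℝ => (u, p.2)) p.1 this (by fun_prop)).sub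
        contDiffAt_const
    refine (h1.congr_of_eventuallyEq ?_).contDiffWithinAt
    have h2 : ContinuousAt (fun u : ℝ => (u, p.2)) p.1 := by fun_prop
    filter_upwards [h2.preimage_mem_nhds (hUo.mem_nhds hp)] with u hu
    have := h _ hu
    simp only at this
    linarith
  · rintro _ ⟨p, hp, rfl⟩
    have h1 : ContDiffAt ℝ ∞ (fun v => f (p.1, v) - φ p.1) p.2 := by
      have := hf.contDiffAt (hUo.mem_nhds hp)
      exact (ContDiffAt.comp (f := fun v : ℝ => (p.1, v)) p.2 this (by fun_prop)).sub
        contDiffAt_const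
    refine (h1.congr_of_eventuallyEq ?_).contDiffWithinAt
    have h2 : ContinuousAt (fun v : ℝ => (p.1, v)) p.2 := by fun_prop
    filter_upwards [h2.preimage_mem_nhds (hUo.mem_nhds hp)] with v hv
    have := h _ hv
    simp only at this
    linarith

namespace IsTranslation

lemma isOpen_fst (h : IsTranslation U f φ ψ) : IsOpen (Prod.fst '' U) :=
  isOpenMap_fst _ h.isOpen

lemma isOpen_snd (h : IsTranslation U f φ ψ) : IsOpen (Prod.snd '' U) :=
  isOpenMap_snd _ h.isOpen

lemma smooth_deriv_fst (h : IsTranslation U f φ ψ) :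
    ContDiffOn ℝ ∞ (deriv φ) (Prod.fst '' U) :=
  ((contDiffOn_infty_iff_deriv_of_isOpen h.isOpen_fst).1 h.smooth_fst).2

lemma smooth_deriv_snd (h : IsTranslation U f φ ψ) :
    ContDiffOn ℝ ∞ (deriv ψ) (Prod.snd '' U) :=
  ((contDiffOn_infty_iff_deriv_of_isOpen h.isOpen_snd).1 h.smooth_snd).2

lemma smooth_deriv2_fst (h : IsTranslation U f φ ψ) :
    ContDiffOn ℝ ∞ (deriv (deriv φ)) (Prod.fst '' U) :=
  ((contDiffOn_infty_iff_deriv_of_isOpen h.isOpen_fst).1 h.smooth_deriv_fst).2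

lemma smooth_deriv2_snd (h : IsTranslation U f φ ψ) :
    ContDiffOn ℝ ∞ (deriv (deriv ψ)) (Prod.snd '' U) :=
  ((contDiffOn_infty_iff_deriv_of_isOpen h.isOpen_snd).1 h.smooth_deriv_snd).2

end IsTranslation

lemma contDiffOn_comp_fst {g : ℝ → ℝ} (hg : ContDiffOn ℝ ∞ g (Prod.fst '' U)) :
    ContDiffOn ℝ ∞ (fun p : ℝ × ℝ => g p.1) U :=
  hg.comp contDiff_fst.contDiffOn (Set.mapsTo_image _ _)

lemma contDiffOn_comp_snd {g : ℝ → ℝ} (hg : ContDiffOn ℝ ∞ g (Prod.snd '' U)) :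
    ContDiffOn ℝ ∞ (fun p : ℝ × ℝ => g p.2) U :=
  hg.comp contDiff_snd.contDiffOn (Set.mapsTo_image _ _)

lemma hasFDerivAt_comp_fst {g : ℝ → ℝ} {g' : ℝ} {p : ℝ × ℝ} (hg : HasDerivAt g g' p.1) :
    HasFDerivAt (fun q : ℝ × ℝ => g q.1) (g' • ContinuousLinearMap.fst ℝ ℝ ℝ) p :=
  HasDerivAt.comp_hasFDerivAt (f := Prod.fst) p hg hasFDerivAt_fst

lemma hasFDerivAt_comp_snd {g : ℝ → ℝ} {g' : ℝ} {p : ℝ × ℝ} (hg : HasDerivAt g g' p.2) :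
    HasFDerivAt (fun q : ℝ × ℝ => g q.2) (g' • ContinuousLinearMap.snd ℝ ℝ ℝ) p :=
  HasDerivAt.comp_hasFDerivAt (f := Prod.snd) p hg hasFDerivAt_snd

namespace IsTranslation

lemma hasDerivAt_fst (h : IsTranslation U f φ ψ) {p : ℝ × ℝ} (hp : p ∈ U) :
    HasDerivAt φ (deriv φ p.1) p.1 :=
  ((h.smooth_fst.contDiffAt (h.isOpen_fst.mem_nhds ⟨p, hp, rfl⟩)).differentiableAt
    (by simp)).hasDerivAt

lemma hasDerivAt_snd (h : IsTranslation U f φ ψ) {p : ℝ × ℝ} (hp : p ∈ U) :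
    HasDerivAt ψ (deriv ψ p.2) p.2 :=
  ((h.smooth_snd.contDiffAt (h.isOpen_snd.mem_nhds ⟨p, hp, rfl⟩)).differentiableAt
    (by simp)).hasDerivAt

lemma hasDerivAt_deriv_fst (h : IsTranslation U f φ ψ) {p : ℝ × ℝ} (hp : p ∈ U) :
    HasDerivAt (deriv φ) (deriv (deriv φ) p.1) p.1 :=
  ((h.smooth_deriv_fst.contDiffAt (h.isOpen_fst.mem_nhds ⟨p, hp, rfl⟩)).differentiableAt
    (by simp)).hasDerivAt

lemma hasDerivAt_deriv_snd (h : IsTranslation U f φ ψ) {p : ℝ × ℝ} (hp : p ∈ U) :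
    HasDerivAt (deriv ψ) (deriv (deriv ψ) p.2) p.2 :=
  ((h.smooth_deriv_snd.contDiffAt (h.isOpen_snd.mem_nhds ⟨p, hp, rfl⟩)).differentiableAt
    (by simp)).hasDerivAt

lemma hasFDerivAt (h : IsTranslation U f φ ψ) {p : ℝ × ℝ} (hp : p ∈ U) :
    HasFDerivAt f (deriv φ p.1 • ContinuousLinearMap.fst ℝ ℝ ℝ +
      deriv ψ p.2 • ContinuousLinearMap.snd ℝ ℝ ℝ) p := by
  have h1 := (hasFDerivAt_comp_fst (h.hasDerivAt_fst hp)).add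
    (hasFDerivAt_comp_snd (h.hasDerivAt_snd hp))
  refine h1.congr_of_eventuallyEq ?_
  filter_upwards [h.isOpen.mem_nhds hp] with q hq
  simp [h.eq q hq]

lemma fderiv_graph (h : IsTranslation U f φ ψ) {p : ℝ × ℝ} (hp : p ∈ U) (X : ℝ × ℝ) :
    fderiv ℝ (graph f) p X = ![X.1, X.2, deriv φ p.1 * X.1 + deriv ψ p.2 * X.2] := by
  have h1 : HasFDerivAt (graph f) (ContinuousLinearMap.pi ![ContinuousLinearMap.fst ℝ ℝ ℝ,
      ContinuousLinearMap.snd ℝ ℝ ℝ, deriv φ p.1 • ContinuousLinearMap.fst ℝ ℝ ℝ +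
      deriv ψ p.2 • ContinuousLinearMap.snd ℝ ℝ ℝ]) p := by
    rw [hasFDerivAt_pi']
    intro i
    fin_cases i
    · exact hasFDerivAt_fst
    · exact hasFDerivAt_snd
    · exact h.hasFDerivAt hp
  rw [h1.fderiv]
  funext i
  fin_cases i <;> simp

lemma fderiv_fderiv_graph (h : IsTranslation U f φ ψ) {p : ℝ × ℝ} (hp : p ∈ U)
    (X Y : ℝ × ℝ) :
    fderiv ℝ (fun q => fderiv ℝ (graph f) q Y) p X =
      ![0, 0, deriv (deriv φ) p.1 * X.1 * Y.1 + deriv (deriv ψ) p.2 * X.2 * Y.2] := by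
  have h0 : (fun q => fderiv ℝ (graph f) q Y) =ᶠ[nhds p]
      fun q => ![Y.1, Y.2, deriv φ q.1 * Y.1 + deriv ψ q.2 * Y.2] := by
    filter_upwards [h.isOpen.mem_nhds hp] with q hq
    exact h.fderiv_graph hq Y
  rw [h0.fderiv_eq]
  have h2 : HasFDerivAt (fun q : ℝ × ℝ => deriv φ q.1 * Y.1 + deriv ψ q.2 * Y.2)
      (Y.1 • deriv (deriv φ) p.1 • ContinuousLinearMap.fst ℝ ℝ ℝ +
      Y.2 • deriv (deriv ψ) p.2 • ContinuousLinearMap.snd ℝ ℝ ℝ) p :=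
    ((hasFDerivAt_comp_fst (h.hasDerivAt_deriv_fst hp)).mul_const Y.1).add
      ((hasFDerivAt_comp_snd (h.hasDerivAt_deriv_snd hp)).mul_const Y.2)
  have h1 : HasFDerivAt (fun q : ℝ × ℝ => ![Y.1, Y.2, deriv φ q.1 * Y.1 + deriv ψ q.2 * Y.2])
      (ContinuousLinearMap.pi ![(0 : ℝ × ℝ →L[ℝ] ℝ), (0 : ℝ × ℝ →L[ℝ] ℝ),
        Y.1 • deriv (deriv φ) p.1 • ContinuousLinearMap.fst ℝ ℝ ℝ +
      Y.2 • deriv (deriv ψ) p.2 • ContinuousLinearMap.snd ℝ ℝ ℝ]) p := by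
    rw [hasFDerivAt_pi']
    intro i
    fin_cases i
    · exact hasFDerivAt_const _ _
    · exact hasFDerivAt_const _ _
    · exact h2
  rw [h1.fderiv]
  funext i
  fin_cases i <;> simp
  ring

end IsTranslation

/-! ### Unit normal and fundamental forms of a translation graph. -/

variable {N : ℝ × ℝ → Fin 3 → ℝ}

namespace IsTranslation

lemma isTimelike_iff (h : IsTranslation U f φ ψ) (hpos : ∀ p ∈ U, 0 < f p) :
    IsTimelike U (graph f) ↔ ∀ p ∈ U, 1 < deriv φ p.1 ^ 2 + deriv ψ p.2 ^ 2 := by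
  refine forall₂_congr fun p hp => ?_
  have hf := hpos p hp
  have key : firstForm (graph f) p (1, 0) (1, 0) * firstForm (graph f) p (0, 1) (0, 1)
      - firstForm (graph f) p (1, 0) (0, 1) ^ 2 =
      (1 - (deriv φ p.1 ^ 2 + deriv ψ p.2 ^ 2)) / f p ^ 4 := by
    simp only [firstForm, metricInner_eq, h.fderiv_graph hp, minkowski, graph]
    simp
    field_simp
    ring
  rw [key, div_neg_iff]
  have : 0 < f p ^ 4 := by positivity
  constructor
  · rintro (⟨_, h2⟩ | ⟨h1, _⟩) <;> linarith
  · intro h1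
    right
    exact ⟨by linarith, this⟩

lemma normal_eq (h : IsTranslation U f φ ψ) (hpos : ∀ p ∈ U, 0 < f p)
    (hN : IsUnitNormal U (graph f) N) {p : ℝ × ℝ} (hp : p ∈ U) :
    N p 0 = N p 2 * deriv φ p.1 ∧ N p 1 = N p 2 * deriv ψ p.2 := by
  have hf := (hpos p hp).ne'
  have h1 := hN.normal p hp (1, 0)
  have h2 := hN.normal p hp (0, 1)
  simp only [metricInner_eq, h.fderiv_graph hp, minkowski, graph] at h1 h2
  simp [hf] at h1 h2
  constructor <;> linarith

lemma normal_sq (h : IsTranslation U f φ ψ) (hpos : ∀ p ∈ U, 0 < f p)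
    (hN : IsUnitNormal U (graph f) N) {p : ℝ × ℝ} (hp : p ∈ U) :
    ((f p)⁻¹ * N p 2) ^ 2 * (deriv φ p.1 ^ 2 + deriv ψ p.2 ^ 2 - 1) = 1 := by
  have hf := (hpos p hp).ne'
  have h1 := hN.unit p hp
  obtain ⟨h2, h3⟩ := h.normal_eq hpos hN hp
  simp only [metricInner_eq, minkowski, h2, h3, graph] at h1
  simp at h1
  linear_combination h1

lemma secondForm_eq (h : IsTranslation U f φ ψ) (hpos : ∀ p ∈ U, 0 < f p)
    (hN : IsUnitNormal U (graph f) N) {p : ℝ × ℝ} (hp : p ∈ U) (X Y : ℝ × ℝ) :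
    secondForm (graph f) N p X Y = -(N p 2 / f p ^ 3) *
      (f p * (deriv (deriv φ) p.1 * X.1 * Y.1 + deriv (deriv ψ) p.2 * X.2 * Y.2)
        + (deriv φ p.1 * X.1 + deriv ψ p.2 * X.2) * (deriv φ p.1 * Y.1 + deriv ψ p.2 * Y.2)
        - X.1 * Y.1 - X.2 * Y.2) := by
  have hf := (hpos p hp).ne'
  have hg : graph f p 2 ≠ 0 := hf
  obtain ⟨h2, h3⟩ := h.normal_eq hpos hN hp
  simp only [secondForm, metricInner_eq, minkowski, covDeriv, sum_christoffel hg,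
    h.fderiv_graph hp, h.fderiv_fderiv_graph hp, h2, h3]
  simp [graph]
  field_simp
  ring

/-- Differentiating `k² W = 1` expresses `W dk` through `k`, and only `k²` survives in the result;
no choice between the two unit normals is needed. -/
lemma fourthForm_eq (h : IsTranslation U f φ ψ) (hpos : ∀ p ∈ U, 0 < f p)
    (hN : IsUnitNormal U (graph f) N) {p : ℝ × ℝ} (hp : p ∈ U) (X Y : ℝ × ℝ) :
    (deriv φ p.1 ^ 2 + deriv ψ p.2 ^ 2 - 1) ^ 2 * fourthForm (graph f) N p X Y =
      (deriv φ p.1 ^ 2 + deriv ψ p.2 ^ 2 - 1) *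
        (deriv (deriv φ) p.1 ^ 2 * X.1 * Y.1 + deriv (deriv ψ) p.2 ^ 2 * X.2 * Y.2) -
      (deriv φ p.1 * deriv (deriv φ) p.1 * X.1 + deriv ψ p.2 * deriv (deriv ψ) p.2 * X.2) *
      (deriv φ p.1 * deriv (deriv φ) p.1 * Y.1 + deriv ψ p.2 * deriv (deriv ψ) p.2 * Y.2) := by
  set k : ℝ × ℝ → ℝ := fun q => (f q)⁻¹ * N q 2 with hk
  have hNd : DifferentiableAt ℝ N p :=
    (hN.smooth.contDiffAt (h.isOpen.mem_nhds hp)).differentiableAt (by simp)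
  have hkd : DifferentiableAt ℝ k p :=
    ((h.hasFDerivAt hp).differentiableAt.inv (hpos p hp).ne').mul
      (differentiableAt_pi.1 hNd 2)
  have hk' := hkd.hasFDerivAt
  set d := fderiv ℝ k p with hd
  have hφ : HasFDerivAt (fun q : ℝ × ℝ => deriv φ q.1)
      (deriv (deriv φ) p.1 • ContinuousLinearMap.fst ℝ ℝ ℝ) p :=
    hasFDerivAt_comp_fst (h.hasDerivAt_deriv_fst hp)
  have hψ : HasFDerivAt (fun q : ℝ × ℝ => deriv ψ q.2)
      (deriv (deriv ψ) p.2 • ContinuousLinearMap.snd ℝ ℝ ℝ) p :=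
    hasFDerivAt_comp_snd (h.hasDerivAt_deriv_snd hp)
  have hgauss : normalGaussMap (graph f) N =ᶠ[nhds p]
      fun q => ![k q * deriv φ q.1, k q * deriv ψ q.2, k q] := by
    filter_upwards [h.isOpen.mem_nhds hp] with q hq
    obtain ⟨h2, h3⟩ := h.normal_eq hpos hN hq
    rw [normalGaussMap_eq]
    funext i
    fin_cases i <;> simp [graph, hk, h2, h3, mul_assoc]
  have hgd : ∀ X, fderiv ℝ (normalGaussMap (graph f) N) p X =
      ![d X * deriv φ p.1 + k p * (deriv (deriv φ) p.1 * X.1),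
        d X * deriv ψ p.2 + k p * (deriv (deriv ψ) p.2 * X.2), d X] := by
    intro X
    have h1 : HasFDerivAt (fun q : ℝ × ℝ => ![k q * deriv φ q.1, k q * deriv ψ q.2, k q])
        (ContinuousLinearMap.pi ![k p • deriv (deriv φ) p.1 • ContinuousLinearMap.fst ℝ ℝ ℝ
          + deriv φ p.1 • d, k p • deriv (deriv ψ) p.2 • ContinuousLinearMap.snd ℝ ℝ ℝ
          + deriv ψ p.2 • d, d]) p := by
      rw [hasFDerivAt_pi']
      intro i
      fin_cases i
      · exact hk'.mul hφ
      · exact hk'.mul hψ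
      · exact hk'
    rw [hgauss.fderiv_eq, h1.fderiv]
    funext i
    fin_cases i <;> simp <;> ring
  have hW : ∀ X, d X * (deriv φ p.1 ^ 2 + deriv ψ p.2 ^ 2 - 1) = -(k p *
      (deriv φ p.1 * deriv (deriv φ) p.1 * X.1 + deriv ψ p.2 * deriv (deriv ψ) p.2 * X.2)) := by
    intro X
    have h1 := (hk'.pow 2).mul (((hφ.pow 2).add (hψ.pow 2)).sub_const 1)
    have h2 : (fun q : ℝ × ℝ => k q ^ 2 * (deriv φ q.1 ^ 2 + deriv ψ q.2 ^ 2 - 1)) =ᶠ[nhds p]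
        fun _ => 1 := by
      filter_upwards [h.isOpen.mem_nhds hp] with q hq
      exact h.normal_sq hpos hN hq
    have h3 := (h1.congr_of_eventuallyEq h2.symm).unique (hasFDerivAt_const (1 : ℝ) p)
    have h4 := congrArg (fun T => T X) h3
    simp at h4
    have hk0 : k p ≠ 0 := by
      intro h0
      have := h.normal_sq hpos hN hp
      simp only [hk] at h0
      rw [h0] at this
      simp at this
    apply mul_left_cancel₀ (mul_ne_zero two_ne_zero hk0)
    linear_combination h4
  have hsq : k p ^ 2 * (deriv φ p.1 ^ 2 + deriv ψ p.2 ^ 2 - 1) = 1 := h.normal_sq hpos hN hp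
  have hX := hW X
  have hY := hW Y
  rw [fourthForm, hgd X, hgd Y]
  simp only [minkowski, Matrix.cons_val_zero, Matrix.cons_val_one, Matrix.cons_val]
  generalize k p = κ at *
  generalize d X = x at *
  generalize d Y = y at *
  generalize deriv (deriv φ) p.1 = a at *
  generalize deriv (deriv ψ) p.2 = b at *
  generalize deriv φ p.1 = r at *
  generalize deriv ψ p.2 = s at *
  set W := r ^ 2 + s ^ 2 - 1 with hWd
  set S := r * a * X.1 + s * b * X.2 with hS
  set T := r * a * Y.1 + s * b * Y.2 with hT
  have e : (x * r + κ * (a * X.1)) * (y * r + κ * (a * Y.1))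
      + (x * s + κ * (b * X.2)) * (y * s + κ * (b * Y.2)) - x * y =
      x * y * W + κ * x * T + κ * y * S + κ ^ 2 * (a ^ 2 * X.1 * Y.1 + b ^ 2 * X.2 * Y.2) := by
    rw [hWd, hS, hT]; ring
  rw [e]
  -- The powers of `W` are distributed so that each of `x`, `y`, `κ ^ 2` carries the factor `W` that
  -- eliminates it.
  have e2 : W ^ 2 * (x * y * W + κ * x * T + κ * y * S
      + κ ^ 2 * (a ^ 2 * X.1 * Y.1 + b ^ 2 * X.2 * Y.2)) =
      W * ((x * W) * (y * W)) + κ * W * (x * W) * T + κ * W * (y * W) * S +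
      (κ ^ 2 * W) * W * (a ^ 2 * X.1 * Y.1 + b ^ 2 * X.2 * Y.2) := by ring
  rw [e2, hX, hY, hsq]
  linear_combination (-S * T) * hsq

end IsTranslation

/-- The conformality equation `φ'' (ψ'² - 1) + ψ'' (φ'² - 1) + f φ'' ψ'' = 0`. -/
noncomputable def conformalDefect (f : ℝ × ℝ → ℝ) (φ ψ : ℝ → ℝ) (p : ℝ × ℝ) : ℝ :=
  deriv (deriv φ) p.1 * (deriv ψ p.2 ^ 2 - 1) + deriv (deriv ψ) p.2 * (deriv φ p.1 ^ 2 - 1)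
    + f p * deriv (deriv φ) p.1 * deriv (deriv ψ) p.2

namespace IsTranslation

/-- The constant `c` absorbs `ρ`, the normal and `W²`, so that the normal field disappears from the
equations. -/
lemma conformal_components (h : IsTranslation U f φ ψ) (hpos : ∀ p ∈ U, 0 < f p)
    (hc : HasConformalNormalGaussMap U (graph f)) {p : ℝ × ℝ} (hp : p ∈ U) :
    ∃ c : ℝ,
      deriv (deriv φ) p.1 ^ 2 * (deriv ψ p.2 ^ 2 - 1) =
        c * (f p * deriv (deriv φ) p.1 + deriv φ p.1 ^ 2 - 1) ∧
      deriv (deriv ψ) p.2 ^ 2 * (deriv φ p.1 ^ 2 - 1) =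
        c * (f p * deriv (deriv ψ) p.2 + deriv ψ p.2 ^ 2 - 1) ∧
      -(deriv φ p.1 * deriv (deriv φ) p.1 * (deriv ψ p.2 * deriv (deriv ψ) p.2)) =
        c * (deriv φ p.1 * deriv ψ p.2) := by
  obtain ⟨N, hN, ρ, -, hρ⟩ := hc
  have key := fun X Y => by
    have h1 := h.fourthForm_eq hpos hN hp X Y
    rw [hρ p hp X Y, h.secondForm_eq hpos hN hp X Y] at h1
    exact h1
  refine ⟨(deriv φ p.1 ^ 2 + deriv ψ p.2 ^ 2 - 1) ^ 2 * ρ p * -(N p 2 / f p ^ 3), ?_, ?_, ?_⟩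
  · have := key (1, 0) (1, 0)
    simp only at this
    linear_combination -this
  · have := key (0, 1) (0, 1)
    simp only at this
    linear_combination -this
  · have := key (1, 0) (0, 1)
    simp only at this
    linear_combination -this

/-- With the factor read off from the mixed coefficient, the two forms differ by a multiple of `E
(φ'' du² + ψ'' dv²)`. -/
lemma conformal_of_defect (h : IsTranslation U f φ ψ) (hpos : ∀ p ∈ U, 0 < f p)
    (ht : ∀ p ∈ U, 1 < deriv φ p.1 ^ 2 + deriv ψ p.2 ^ 2)
    (hE : ∀ p ∈ U, conformalDefect f φ ψ p = 0) :
    HasConformalNormalGaussMap U (graph f) := by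
  have hfs : ContDiffOn ℝ ∞ f U :=
    ((contDiffOn_comp_fst h.smooth_fst).add (contDiffOn_comp_snd h.smooth_snd)).congr h.eq
  have hφ := contDiffOn_comp_fst h.smooth_deriv_fst
  have hψ := contDiffOn_comp_snd h.smooth_deriv_snd
  set w : ℝ × ℝ → ℝ := fun p => √(deriv φ p.1 ^ 2 + deriv ψ p.2 ^ 2 - 1) with hw
  have hw0 : ∀ p ∈ U, 0 < w p := fun p hp => Real.sqrt_pos.2 (by linarith [ht p hp])
  have hw2 : ∀ p ∈ U, w p ^ 2 = deriv φ p.1 ^ 2 + deriv ψ p.2 ^ 2 - 1 :=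
    fun p hp => Real.sq_sqrt (by linarith [ht p hp])
  have hws : ContDiffOn ℝ ∞ w U :=
    (((hφ.pow 2).add (hψ.pow 2)).sub contDiffOn_const).sqrt
      fun p hp => by have := ht p hp; simp; linarith
  have hfw : ContDiffOn ℝ ∞ (fun p => f p / w p) U := hfs.div hws fun p hp => (hw0 p hp).ne'
  set N : ℝ × ℝ → Fin 3 → ℝ :=
    fun p => ![f p / w p * deriv φ p.1, f p / w p * deriv ψ p.2, f p / w p] with hNdef
  have hN : IsUnitNormal U (graph f) N := by
    refine ⟨?_, ?_, ?_⟩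
    · rw [contDiffOn_pi]
      intro i
      fin_cases i
      · exact hfw.mul hφ
      · exact hfw.mul hψ
      · exact hfw
    · intro p hp
      have := hw0 p hp
      have := hpos p hp
      have := hw2 p hp
      simp [metricInner_eq, minkowski, hNdef, graph]
      field_simp
      linarith
    · intro p hp X
      simp [metricInner_eq, minkowski, hNdef, graph, h.fderiv_graph hp]
      left
      ring
  -- This solves `W² ρ (-N₃ / f³) = -φ'' ψ''` for `ρ`, with `W = w²` and `N₃ = f / w`.
  refine ⟨N, hN, fun p => deriv (deriv φ) p.1 * deriv (deriv ψ) p.2 * f p ^ 2 / w p ^ 3, ?_, ?_⟩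
  · exact (((contDiffOn_comp_fst h.smooth_deriv2_fst).mul
      (contDiffOn_comp_snd h.smooth_deriv2_snd)).mul (hfs.pow 2)).div (hws.pow 3)
      fun p hp => (pow_pos (hw0 p hp) 3).ne'
  · intro p hp X Y
    have h0 := hw0 p hp
    have h1 := hpos p hp
    have h2 := h.fourthForm_eq hpos hN hp X Y
    have h3 := hE p hp
    rw [h.secondForm_eq hpos hN hp X Y]
    rw [← hw2 p hp] at h2
    apply mul_left_cancel₀ (pow_pos (pow_pos h0 2) 2).ne'
    rw [h2]
    have h4 : N p 2 = f p / w p := rfl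
    rw [h4]
    simp only [conformalDefect] at h3
    have h5 : ∀ a b B : ℝ, (w p ^ 2) ^ 2 * (a * b * f p ^ 2 / w p ^ 3 *
        (-(f p / w p / f p ^ 3) * B)) = -(a * b * B) := by
      intro a b B
      field_simp
    rw [h5, hw2 p hp]
    linear_combination (deriv (deriv φ) p.1 * X.1 * Y.1 + deriv (deriv ψ) p.2 * X.2 * Y.2) * h3

end IsTranslation

/-! ### Passage to slices, local constancy and closures. -/

lemma eventually_of_eventually_fst {P : ℝ → Prop} {z : ℝ × ℝ} (h : ∀ᶠ q in 𝓝 z, P q.1) :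
    ∀ᶠ u in 𝓝 z.1, P u := by
  have : ContinuousAt (fun u : ℝ => (u, z.2)) z.1 := by fun_prop
  exact this.eventually h

lemma eventually_of_eventually_snd {P : ℝ → Prop} {z : ℝ × ℝ} (h : ∀ᶠ q in 𝓝 z, P q.2) :
    ∀ᶠ v in 𝓝 z.2, P v := by
  have : ContinuousAt (fun v : ℝ => (z.1, v)) z.2 := by fun_prop
  exact this.eventually h

lemma deriv_eq_zero_of_eventually {g : ℝ → ℝ} {u c : ℝ} (h : ∀ᶠ t in 𝓝 u, g t = c) :
    deriv g u = 0 := by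
  have : g =ᶠ[𝓝 u] fun _ => c := h
  rw [this.deriv_eq]
  simp

lemma eventually_eq_of_deriv_eq_zero {g : ℝ → ℝ} {u : ℝ}
    (hg : ∀ᶠ t in 𝓝 u, HasDerivAt g 0 t) : ∀ᶠ t in 𝓝 u, g t = g u := by
  obtain ⟨r, hr, hb⟩ := Metric.eventually_nhds_iff_ball.1 hg
  filter_upwards [Metric.ball_mem_nhds u hr] with t ht
  exact Metric.isOpen_ball.is_const_of_deriv_eq_zero (convex_ball u r).isPreconnected
    (fun s hs => (hb s hs).differentiableAt.differentiableWithinAt)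
    (fun s hs => (hb s hs).deriv) ht (Metric.mem_ball_self hr)

lemma eq_of_mem_closure {X : Type*} [TopologicalSpace X] {T : Set X} {g : X → ℝ} {w : X} {c : ℝ}
    (hw : w ∈ closure T) (hg : ContinuousAt g w) (h : ∀ z ∈ T, g z = c) : g w = c :=
  (isClosed_singleton (x := c)).mem_of_frequently_of_tendsto
    ((mem_closure_iff_frequently.1 hw).mono fun z hz => h z hz) hg

/-! ### The ordinary differential equation of the summands -/

/-- Differentiate the hypothesis twice and halve. -/
lemma ode_of_sq_eq {g : ℝ → ℝ} {u u₀ k : ℝ}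
    (hg : ∀ᶠ t in 𝓝 u, HasDerivAt g (deriv g t) t)
    (hg' : HasDerivAt (deriv g) (deriv (deriv g) u) u)
    (h : ∀ᶠ t in 𝓝 u, g t ^ 2 = (t - u₀) ^ 2 + k) :
    g u * deriv (deriv g) u + deriv g u ^ 2 = 1 := by
  have h1 : ∀ᶠ t in 𝓝 u, g t * deriv g t = t - u₀ := by
    filter_upwards [hg, h.eventually_nhds] with t ht hs
    have e1 := ht.pow 2
    have e2 := (((hasDerivAt_id t).sub_const u₀).pow 2).add_const k
    have e3 := (e1.congr_of_eventuallyEq (hs.mono fun s hs => hs.symm)).unique e2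
    simp at e3
    linarith
  have e1 := hg.self_of_nhds.mul hg'
  have e2 := (hasDerivAt_id u).sub_const u₀
  have e3 := (e1.congr_of_eventuallyEq (h1.mono fun s hs => hs.symm)).unique e2
  linear_combination e3

/-- For `y = g - c` the equation reads `(y y')' = 1`, so `y y' - t` is constant, and then so is `y²
- (t - u₀)²`. -/
lemma first_integrals_of_ode {g : ℝ → ℝ} {u u₀ k c : ℝ}
    (hg : ∀ᶠ t in 𝓝 u, HasDerivAt g (deriv g t) t)
    (hg' : ∀ᶠ t in 𝓝 u, HasDerivAt (deriv g) (deriv (deriv g) t) t)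
    (hode : ∀ᶠ t in 𝓝 u, (g t - c) * deriv (deriv g) t + deriv g t ^ 2 = 1)
    (h1 : deriv g u * (g u - c) = u - u₀) (h2 : (g u - c) ^ 2 = (u - u₀) ^ 2 + k) :
    ∀ᶠ t in 𝓝 u, deriv g t * (g t - c) = t - u₀ ∧ (g t - c) ^ 2 = (t - u₀) ^ 2 + k := by
  have e1 : ∀ᶠ t in 𝓝 u, deriv g t * (g t - c) - (t - u₀) =
      deriv g u * (g u - c) - (u - u₀) := by
    apply eventually_eq_of_deriv_eq_zero (g := fun t => deriv g t * (g t - c) - (t - u₀))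
    filter_upwards [hg, hg', hode] with t ht ht' hot
    have := (ht'.mul (ht.sub_const c)).sub ((hasDerivAt_id t).sub_const u₀)
    refine this.congr_deriv ?_
    linear_combination hot
  have e2 : ∀ᶠ t in 𝓝 u, (g t - c) ^ 2 - (t - u₀) ^ 2 = (g u - c) ^ 2 - (u - u₀) ^ 2 := by
    apply eventually_eq_of_deriv_eq_zero (g := fun t => (g t - c) ^ 2 - (t - u₀) ^ 2)
    filter_upwards [hg, e1] with t ht hot
    have := ((ht.sub_const c).pow 2).sub (((hasDerivAt_id t).sub_const u₀).pow 2)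
    refine this.congr_deriv ?_
    simp
    linear_combination 2 * hot + 2 * h1
  filter_upwards [e1, e2] with t h3 h4
  constructor <;> linarith

namespace IsTranslation

lemma eventually_hasDerivAt_fst (h : IsTranslation U f φ ψ) {p : ℝ × ℝ} (hp : p ∈ U) :
    ∀ᶠ u in 𝓝 p.1, HasDerivAt φ (deriv φ u) u :=
  eventually_of_eventually_fst (P := fun u => HasDerivAt φ (deriv φ u) u)
    ((h.isOpen.eventually_mem hp).mono fun _ hq => h.hasDerivAt_fst hq)

lemma eventually_hasDerivAt_deriv_fst (h : IsTranslation U f φ ψ) {p : ℝ × ℝ} (hp : p ∈ U) :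
    ∀ᶠ u in 𝓝 p.1, HasDerivAt (deriv φ) (deriv (deriv φ) u) u :=
  eventually_of_eventually_fst (P := fun u => HasDerivAt (deriv φ) (deriv (deriv φ) u) u)
    ((h.isOpen.eventually_mem hp).mono fun _ hq => h.hasDerivAt_deriv_fst hq)

lemma swap (h : IsTranslation U f φ ψ) :
    IsTranslation (Prod.swap ⁻¹' U) (f ∘ Prod.swap) ψ φ := by
  refine ⟨h.isOpen.preimage continuous_swap, ?_, ?_, ?_⟩
  · refine h.smooth_snd.mono ?_
    rintro _ ⟨p, hp, rfl⟩
    exact ⟨p.swap, hp, rfl⟩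
  · refine h.smooth_fst.mono ?_
    rintro _ ⟨p, hp, rfl⟩
    exact ⟨p.swap, hp, rfl⟩
  · intro p hp
    simp [h.eq _ hp, add_comm]

lemma continuousAt (h : IsTranslation U f φ ψ) {p : ℝ × ℝ} (hp : p ∈ U) :
    ContinuousAt (fun q : ℝ × ℝ => φ q.1) p ∧ ContinuousAt (fun q : ℝ × ℝ => deriv φ q.1) p ∧
      ContinuousAt (fun q : ℝ × ℝ => deriv (deriv φ) q.1) p := by
  have hn := h.isOpen.mem_nhds hp
  exact ⟨(contDiffOn_comp_fst h.smooth_fst).continuousOn.continuousAt hn,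
    (contDiffOn_comp_fst h.smooth_deriv_fst).continuousOn.continuousAt hn,
    (contDiffOn_comp_fst h.smooth_deriv2_fst).continuousOn.continuousAt hn⟩

lemma continuousAt' (h : IsTranslation U f φ ψ) {p : ℝ × ℝ} (hp : p ∈ U) :
    ContinuousAt (fun q : ℝ × ℝ => ψ q.2) p ∧ ContinuousAt (fun q : ℝ × ℝ => deriv ψ q.2) p ∧
      ContinuousAt (fun q : ℝ × ℝ => deriv (deriv ψ) q.2) p := by
  have hn := h.isOpen.mem_nhds hp
  exact ⟨(contDiffOn_comp_snd h.smooth_snd).continuousOn.continuousAt hn,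
    (contDiffOn_comp_snd h.smooth_deriv_snd).continuousOn.continuousAt hn,
    (contDiffOn_comp_snd h.smooth_deriv2_snd).continuousOn.continuousAt hn⟩

/-- At each point of a conformal graph, the conformality equation holds or both second
derivatives vanish. -/
lemma defect_eq_zero_or (h : IsTranslation U f φ ψ) (hpos : ∀ p ∈ U, 0 < f p)
    (ht : ∀ p ∈ U, 1 < deriv φ p.1 ^ 2 + deriv ψ p.2 ^ 2)
    (hc : HasConformalNormalGaussMap U (graph f)) {p : ℝ × ℝ} (hp : p ∈ U) :
    conformalDefect f φ ψ p = 0 ∨ (deriv (deriv φ) p.1 = 0 ∧ deriv (deriv ψ) p.2 = 0) := by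
  by_contra! hcon
  obtain ⟨hE, hne⟩ := hcon
  obtain ⟨c0, c1, c2⟩ := h.continuousAt hp
  obtain ⟨d0, d1, d2⟩ := h.continuousAt' hp
  have hfc : ContinuousAt f p := (h.hasFDerivAt hp).continuousAt
  have hcont : ContinuousAt (conformalDefect f φ ψ) p :=
    ((c2.mul ((d1.pow 2).sub continuousAt_const)).add
      (d2.mul ((c1.pow 2).sub continuousAt_const))).add ((hfc.mul c2).mul d2)
  -- Near `p` the defect stays nonzero and the second derivatives do not both vanish, whereas `φ' ψ'
  -- ≠ 0` would give `φ'' E = ψ'' E = 0`.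
  have hev : ∀ᶠ q in 𝓝 p, deriv φ q.1 = 0 ∨ deriv ψ q.2 = 0 := by
    have hG : ContinuousAt (fun q : ℝ × ℝ => deriv (deriv φ) q.1 ^ 2 + deriv (deriv ψ) q.2 ^ 2) p :=
      (c2.pow 2).add (d2.pow 2)
    have hG0 : deriv (deriv φ) p.1 ^ 2 + deriv (deriv ψ) p.2 ^ 2 ≠ 0 := by
      intro h0
      have h1 : deriv (deriv φ) p.1 = 0 := by nlinarith [sq_nonneg (deriv (deriv ψ) p.2)]
      exact hne h1 (by rw [h1] at h0; simpa using h0)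
    filter_upwards [h.isOpen.mem_nhds hp, hcont.eventually_ne hE, hG.eventually_ne hG0]
      with q hq hEq hGq
    by_contra! hq0
    obtain ⟨c, e1, e2, e3⟩ := h.conformal_components hpos hc hq
    have hcv : c = -(deriv (deriv φ) q.1 * deriv (deriv ψ) q.2) := by
      apply mul_right_cancel₀ (mul_ne_zero hq0.1 hq0.2)
      linear_combination -e3
    have f1 : deriv (deriv φ) q.1 * conformalDefect f φ ψ q = 0 := by
      rw [hcv] at e1
      simp only [conformalDefect]
      linear_combination e1
    have f2 : deriv (deriv ψ) q.2 * conformalDefect f φ ψ q = 0 := by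
      rw [hcv] at e2
      simp only [conformalDefect]
      linear_combination e2
    have g1 := (mul_eq_zero.1 f1).resolve_right hEq
    have g2 := (mul_eq_zero.1 f2).resolve_right hEq
    exact hGq (by rw [g1, g2]; simp)
  obtain ⟨c, e1, e2, -⟩ := h.conformal_components hpos hc hp
  have htp := ht p hp
  -- If `φ'` vanishes at `p`, then `ψ' ≠ 0` by time-likeness, so `φ'` vanishes near `p` and `φ'' =
  -- 0`. The first diagonal equation becomes `0 = -c`, and the second then gives `ψ'' = 0`.
  rcases hev.self_of_nhds with h0 | h0
  · have hψ0 : deriv ψ p.2 ≠ 0 := by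
      intro h1; rw [h0, h1] at htp; norm_num at htp
    have : ∀ᶠ q in 𝓝 p, deriv φ q.1 = 0 := by
      filter_upwards [hev, d1.eventually_ne hψ0] with q h1 h2
      exact h1.resolve_right h2
    have h2 := deriv_eq_zero_of_eventually
      (eventually_of_eventually_fst (P := fun u => deriv φ u = 0) this)
    simp only [h0, h2] at e1 e2
    have hc0 : c = 0 := by linarith
    rw [hc0] at e2
    exact hne h2 (by nlinarith)
  · have hφ0 : deriv φ p.1 ≠ 0 := by
      intro h1; rw [h0, h1] at htp; norm_num at htp
    have : ∀ᶠ q in 𝓝 p, deriv ψ q.2 = 0 := by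
      filter_upwards [hev, c1.eventually_ne hφ0] with q h1 h2
      exact h1.resolve_left h2
    have h2 := deriv_eq_zero_of_eventually
      (eventually_of_eventually_snd (P := fun u => deriv ψ u = 0) this)
    simp only [h0, h2] at e1 e2
    have hc0 : c = 0 := by linarith
    rw [hc0] at e1
    exact hne (by nlinarith) h2

/-! ### Graphs of radical type -/

/-- Near a point with `φ'' ψ'' ≠ 0`, the conformality equation separates. -/
lemma eventually_ode (h : IsTranslation U f φ ψ)
    (hE : ∀ p ∈ U, conformalDefect f φ ψ p = 0 ∨
      (deriv (deriv φ) p.1 = 0 ∧ deriv (deriv ψ) p.2 = 0))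
    {p : ℝ × ℝ} (hp : p ∈ U) {c : ℝ} (hψ2 : deriv (deriv ψ) p.2 ≠ 0)
    (hode : (ψ p.2 + c) * deriv (deriv ψ) p.2 + deriv ψ p.2 ^ 2 = 1) :
    ∀ᶠ t in 𝓝 p.1, (φ t - c) * deriv (deriv φ) t + deriv φ t ^ 2 = 1 := by
  have hcont : ContinuousAt (fun u : ℝ => (u, p.2)) p.1 := by fun_prop
  filter_upwards [hcont.eventually (h.isOpen.mem_nhds hp)] with t ht
  have ht : (t, p.2) ∈ U := ht
  -- Fixing the second variable at `p.2` removes the `ψ` bracket of the separated defect and leaves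
  -- `ψ''` times the `φ` bracket.
  have hd := (hE _ ht).resolve_right fun h0 => hψ2 h0.2
  simp only [conformalDefect, h.eq _ ht] at hd
  apply mul_left_cancel₀ hψ2
  linear_combination hd - deriv (deriv φ) t * hode

lemma eventually_first_integrals (h : IsTranslation U f φ ψ)
    (hE : ∀ p ∈ U, conformalDefect f φ ψ p = 0 ∨
      (deriv (deriv φ) p.1 = 0 ∧ deriv (deriv ψ) p.2 = 0))
    {p : ℝ × ℝ} (hp : p ∈ U) {c u₀ k : ℝ} (hψ2 : deriv (deriv ψ) p.2 ≠ 0)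
    (hode : (ψ p.2 + c) * deriv (deriv ψ) p.2 + deriv ψ p.2 ^ 2 = 1)
    (h1 : deriv φ p.1 * (φ p.1 - c) = p.1 - u₀)
    (h2 : (φ p.1 - c) ^ 2 = (p.1 - u₀) ^ 2 + k) :
    ∀ᶠ q in 𝓝 p, (φ q.1 - c) * deriv (deriv φ) q.1 + deriv φ q.1 ^ 2 = 1 ∧
      deriv φ q.1 * (φ q.1 - c) = q.1 - u₀ ∧ (φ q.1 - c) ^ 2 = (q.1 - u₀) ^ 2 + k := by
  have e1 := h.eventually_ode hE hp hψ2 hode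
  have e2 := first_integrals_of_ode (h.eventually_hasDerivAt_fst hp)
    (h.eventually_hasDerivAt_deriv_fst hp) e1 h1 h2
  have hf : Tendsto (Prod.fst : ℝ × ℝ → ℝ) (𝓝 p) (𝓝 p.1) := continuous_fst.continuousAt
  exact hf.eventually (e1.and e2)

lemma defect_swap (f : ℝ × ℝ → ℝ) (φ ψ : ℝ → ℝ) (p : ℝ × ℝ) :
    conformalDefect (f ∘ Prod.swap) ψ φ p = conformalDefect f φ ψ p.swap := by
  simp [conformalDefect]
  ring

lemma defect_eq_zero_or_swap
    (hE : ∀ p ∈ U, conformalDefect f φ ψ p = 0 ∨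
      (deriv (deriv φ) p.1 = 0 ∧ deriv (deriv ψ) p.2 = 0)) :
    ∀ p ∈ Prod.swap ⁻¹' U, conformalDefect (f ∘ Prod.swap) ψ φ p = 0 ∨
      (deriv (deriv ψ) p.1 = 0 ∧ deriv (deriv φ) p.2 = 0) := by
  intro p hp
  rw [defect_swap]
  exact (hE _ hp).imp id And.symm

lemma eventually_first_integrals' (h : IsTranslation U f φ ψ)
    (hE : ∀ p ∈ U, conformalDefect f φ ψ p = 0 ∨
      (deriv (deriv φ) p.1 = 0 ∧ deriv (deriv ψ) p.2 = 0))
    {p : ℝ × ℝ} (hp : p ∈ U) {c v₀ l : ℝ} (hφ2 : deriv (deriv φ) p.1 ≠ 0)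
    (hode : (φ p.1 - c) * deriv (deriv φ) p.1 + deriv φ p.1 ^ 2 = 1)
    (h1 : deriv ψ p.2 * (ψ p.2 + c) = p.2 - v₀)
    (h2 : (ψ p.2 + c) ^ 2 = (p.2 - v₀) ^ 2 + l) :
    ∀ᶠ q in 𝓝 p, (ψ q.2 + c) * deriv (deriv ψ) q.2 + deriv ψ q.2 ^ 2 = 1 ∧
      deriv ψ q.2 * (ψ q.2 + c) = q.2 - v₀ ∧ (ψ q.2 + c) ^ 2 = (q.2 - v₀) ^ 2 + l := by
  -- Interchanging the variables exchanges `φ - c` with `ψ + c`, hence `c` with `-c`.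
  have := h.swap.eventually_first_integrals (defect_eq_zero_or_swap hE) (p := p.swap) hp (c := -c)
    (u₀ := v₀) (k := l) hφ2 (by simpa [sub_eq_add_neg] using hode) (by simpa using h1)
    (by simpa using h2)
  have hs : Tendsto (Prod.swap : ℝ × ℝ → ℝ × ℝ) (𝓝 p) (𝓝 p.swap) := continuous_swap.continuousAt
  simpa using hs.eventually this

/-- Multiply the equation by `y²`. For `k ≠ 0` this keeps both `y` and `y''` away from zero, which
is what lets the solution propagate. -/
lemma cube_mul_eq {y y' y'' t k : ℝ} (h0 : y * y'' + y' ^ 2 = 1) (h1 : y' * y = t)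
    (h2 : y ^ 2 = t ^ 2 + k) : y ^ 3 * y'' = k := by
  subst h1
  linear_combination y ^ 2 * h0 + h2

/-- For `k = 0`, `y³ y'' = 0` and `y'' ≠ 0` would make `y = g - c` vanish near `u`, hence also
`y''`. -/
lemma const_ne_zero {g : ℝ → ℝ} {u u₀ k c : ℝ}
    (hev : ∀ᶠ t in 𝓝 u, (g t - c) * deriv (deriv g) t + deriv g t ^ 2 = 1 ∧
      deriv g t * (g t - c) = t - u₀ ∧ (g t - c) ^ 2 = (t - u₀) ^ 2 + k)
    (hne : ∀ᶠ t in 𝓝 u, deriv (deriv g) t ≠ 0) : k ≠ 0 := by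
  rintro rfl
  have h1 : ∀ᶠ t in 𝓝 u, g t = c := by
    filter_upwards [hev, hne] with t ⟨h1, h2, h3⟩ h4
    have := (mul_eq_zero.1 (cube_mul_eq h1 h2 h3)).resolve_right h4
    have := pow_eq_zero_iff (three_ne_zero) |>.1 this
    linarith
  have h2 : ∀ᶠ t in 𝓝 u, deriv g t = 0 :=
    h1.eventually_nhds.mono fun t ht => deriv_eq_zero_of_eventually ht
  exact hne.self_of_nhds (deriv_eq_zero_of_eventually h2)

/-- If `φ'' ψ''` does not vanish identically, both summands are square roots. -/
lemma exists_sq_eq (h : IsTranslation U f φ ψ) (hUc : IsPreconnected U)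
    (hE : ∀ p ∈ U, conformalDefect f φ ψ p = 0 ∨
      (deriv (deriv φ) p.1 = 0 ∧ deriv (deriv ψ) p.2 = 0))
    {p : ℝ × ℝ} (hp : p ∈ U) (hφ2 : deriv (deriv φ) p.1 ≠ 0) (hψ2 : deriv (deriv ψ) p.2 ≠ 0) :
    ∃ c u₀ k v₀ l : ℝ, k ≠ 0 ∧ l ≠ 0 ∧ ∀ q ∈ U, φ q.1 - c ≠ 0 ∧ ψ q.2 + c ≠ 0 ∧
      (φ q.1 - c) ^ 2 = (q.1 - u₀) ^ 2 + k ∧ (ψ q.2 + c) ^ 2 = (q.2 - v₀) ^ 2 + l := by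
  -- The constant is chosen so that the equation for `φ - c` holds at `p`; the one for `ψ + c` then
  -- follows from `E = 0`. The other constants are the values of the first integrals at `p`.
  obtain ⟨c, hcd⟩ : ∃ c, c = φ p.1 + (deriv φ p.1 ^ 2 - 1) / deriv (deriv φ) p.1 := ⟨_, rfl⟩
  have o1 : (φ p.1 - c) * deriv (deriv φ) p.1 + deriv φ p.1 ^ 2 = 1 := by
    rw [hcd]; field_simp; ring
  have o2 : (ψ p.2 + c) * deriv (deriv ψ) p.2 + deriv ψ p.2 ^ 2 = 1 := by
    have hd := (hE p hp).resolve_right fun h0 => hφ2 h0.1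
    simp only [conformalDefect, h.eq p hp] at hd
    apply mul_left_cancel₀ hφ2
    linear_combination hd - deriv (deriv ψ) p.2 * o1
  obtain ⟨u₀, hu₀⟩ : ∃ u₀, deriv φ p.1 * (φ p.1 - c) = p.1 - u₀ :=
    ⟨p.1 - deriv φ p.1 * (φ p.1 - c), by ring⟩
  obtain ⟨k, hk⟩ : ∃ k, (φ p.1 - c) ^ 2 = (p.1 - u₀) ^ 2 + k :=
    ⟨(φ p.1 - c) ^ 2 - (p.1 - u₀) ^ 2, by ring⟩
  obtain ⟨v₀, hv₀⟩ : ∃ v₀, deriv ψ p.2 * (ψ p.2 + c) = p.2 - v₀ :=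
    ⟨p.2 - deriv ψ p.2 * (ψ p.2 + c), by ring⟩
  obtain ⟨l, hl⟩ : ∃ l, (ψ p.2 + c) ^ 2 = (p.2 - v₀) ^ 2 + l :=
    ⟨(ψ p.2 + c) ^ 2 - (p.2 - v₀) ^ 2, by ring⟩
  obtain ⟨c0, c1, c2⟩ := h.continuousAt hp
  obtain ⟨d0, d1, d2⟩ := h.continuousAt' hp
  have hk0 : k ≠ 0 := const_ne_zero
    (eventually_of_eventually_fst (P := fun t =>
      (φ t - c) * deriv (deriv φ) t + deriv φ t ^ 2 = 1 ∧ deriv φ t * (φ t - c) = t - u₀ ∧ (φ t - c) ^ 2 = (t - u₀) ^ 2 + k)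
      (h.eventually_first_integrals hE hp hψ2 o2 hu₀ hk))
    (eventually_of_eventually_fst (P := fun t => deriv (deriv φ) t ≠ 0) (c2.eventually_ne hφ2))
  have hl0 : l ≠ 0 := const_ne_zero (c := -c)
    (eventually_of_eventually_snd (P := fun t =>
      (ψ t - -c) * deriv (deriv ψ) t + deriv ψ t ^ 2 = 1 ∧ deriv ψ t * (ψ t - -c) = t - v₀ ∧ (ψ t - -c) ^ 2 = (t - v₀) ^ 2 + l)
      (by simpa using h.eventually_first_integrals' hE hp hφ2 o1 hv₀ hl))
    (eventually_of_eventually_snd (P := fun t => deriv (deriv ψ) t ≠ 0) (d2.eventually_ne hψ2))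
  -- The points where both equations and all first integrals hold with the constants found at `p`.
  -- This set is open and relatively closed in `U`; openness uses that `k, l ≠ 0` keep both second
  -- derivatives nonzero.
  set T : Set (ℝ × ℝ) := {q | q ∈ U ∧
    ((φ q.1 - c) * deriv (deriv φ) q.1 + deriv φ q.1 ^ 2 = 1 ∧
      deriv φ q.1 * (φ q.1 - c) = q.1 - u₀ ∧ (φ q.1 - c) ^ 2 = (q.1 - u₀) ^ 2 + k) ∧
    ((ψ q.2 + c) * deriv (deriv ψ) q.2 + deriv ψ q.2 ^ 2 = 1 ∧
      deriv ψ q.2 * (ψ q.2 + c) = q.2 - v₀ ∧ (ψ q.2 + c) ^ 2 = (q.2 - v₀) ^ 2 + l)} with hT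
  have hTc : ∀ q ∈ T, (φ q.1 - c) ^ 3 * deriv (deriv φ) q.1 = k ∧
      (ψ q.2 + c) ^ 3 * deriv (deriv ψ) q.2 = l := by
    rintro q ⟨-, ⟨a1, a2, a3⟩, b1, b2, b3⟩
    exact ⟨cube_mul_eq a1 a2 a3, cube_mul_eq b1 b2 b3⟩
  have hTo : IsOpen T := by
    rw [isOpen_iff_mem_nhds]
    intro q hqT
    obtain ⟨g1, g2⟩ := hTc q hqT
    obtain ⟨hq, ⟨a1, a2, a3⟩, b1, b2, b3⟩ := hqT
    have n1 : deriv (deriv φ) q.1 ≠ 0 := fun h0 => hk0 (by rw [← g1, h0, mul_zero])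
    have n2 : deriv (deriv ψ) q.2 ≠ 0 := fun h0 => hl0 (by rw [← g2, h0, mul_zero])
    filter_upwards [h.isOpen.mem_nhds hq, h.eventually_first_integrals hE hq n2 b1 a2 a3,
      h.eventually_first_integrals' hE hq n1 a1 b2 b3] with r hr x1 x2
    exact ⟨hr, x1, x2⟩
  have hTcl : closure T ∩ U ⊆ T := by
    rintro w ⟨hw, hwU⟩
    obtain ⟨c0, c1, c2⟩ := h.continuousAt hwU
    obtain ⟨d0, d1, d2⟩ := h.continuousAt' hwU
    have cf : ContinuousAt (Prod.fst : ℝ × ℝ → ℝ) w := continuous_fst.continuousAt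
    have cs : ContinuousAt (Prod.snd : ℝ × ℝ → ℝ) w := continuous_snd.continuousAt
    have c0' := c0.sub (continuousAt_const (y := c))
    have d0' := d0.add (continuousAt_const (y := c))
    refine ⟨hwU, ⟨?_, ?_, ?_⟩, ?_, ?_, ?_⟩
    · have e := eq_of_mem_closure (c := 1) hw ((c0'.mul c2).add (c1.pow 2))
        fun z hz => hz.2.1.1
      exact e
    · have e := eq_of_mem_closure (c := 0) hw
        ((c1.mul c0').sub (cf.sub (continuousAt_const (y := u₀))))
        fun z hz => sub_eq_zero.2 hz.2.1.2.1
      exact sub_eq_zero.1 e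
    · have e := eq_of_mem_closure (c := 0) hw ((c0'.pow 2).sub
        (((cf.sub (continuousAt_const (y := u₀))).pow 2).add (continuousAt_const (y := k))))
        fun z hz => sub_eq_zero.2 hz.2.1.2.2
      exact sub_eq_zero.1 e
    · have e := eq_of_mem_closure (c := 1) hw ((d0'.mul d2).add (d1.pow 2))
        fun z hz => hz.2.2.1
      exact e
    · have e := eq_of_mem_closure (c := 0) hw
        ((d1.mul d0').sub (cs.sub (continuousAt_const (y := v₀))))
        fun z hz => sub_eq_zero.2 hz.2.2.2.1
      exact sub_eq_zero.1 e
    · have e := eq_of_mem_closure (c := 0) hw ((d0'.pow 2).sub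
        (((cs.sub (continuousAt_const (y := v₀))).pow 2).add (continuousAt_const (y := l))))
        fun z hz => sub_eq_zero.2 hz.2.2.2.2
      exact sub_eq_zero.1 e
  have hsub : U ⊆ T := hUc.subset_of_closure_inter_subset hTo
    ⟨p, hp, hp, ⟨o1, hu₀, hk⟩, o2, hv₀, hl⟩ hTcl
  refine ⟨c, u₀, k, v₀, l, hk0, hl0, fun q hq => ?_⟩
  obtain ⟨g1, g2⟩ := hTc q (hsub hq)
  exact ⟨fun h0 => hk0 (by rw [← g1, h0]; simp), fun h0 => hl0 (by rw [← g2, h0]; simp),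
    (hsub hq).2.1.2.2, (hsub hq).2.2.2.2⟩

end IsTranslation

lemma eq_mul_sqrt_of_sq_eq {X : Type*} [TopologicalSpace X] {S : Set X} (hS : IsPreconnected S)
    {g r : X → ℝ} (hg : ContinuousOn g S) (hr : ContinuousOn r S)
    (hne : ∀ x ∈ S, g x ≠ 0) (hsq : ∀ x ∈ S, g x ^ 2 = r x) :
    ∃ ε : ℝ, (ε = 1 ∨ ε = -1) ∧ ∀ x ∈ S, g x = ε * √(r x) := by
  have hrpos : ∀ x ∈ S, 0 < r x := fun x hx => by
    rw [← hsq x hx]; have := hne x hx; positivity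
  rcases hS.eq_or_eq_neg_of_sq_eq hg hr.sqrt
    (fun x hx => by simp [Real.sq_sqrt (hrpos x hx).le, hsq x hx])
    (fun {x} hx => (Real.sqrt_pos.2 (hrpos x hx)).ne') with h | h
  · exact ⟨1, Or.inl rfl, fun x hx => by simpa using h hx⟩
  · exact ⟨-1, Or.inr rfl, fun x hx => by simpa using h hx⟩

lemma exists_sq_or_neg_sq {k : ℝ} (hk : k ≠ 0) : ∃ a : ℝ, a ≠ 0 ∧ (k = a ^ 2 ∨ k = -a ^ 2) := by
  refine ⟨√|k|, (Real.sqrt_pos.2 (abs_pos.2 hk)).ne', ?_⟩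
  rw [Real.sq_sqrt (abs_nonneg k)]
  rcases abs_choice k with h | h <;> rw [h] <;> simp

lemma isRadicalSum_of_eq {u₀ k v₀ l ε : ℝ} (hk : k ≠ 0) (hl : l ≠ 0) (hε : ε = 1 ∨ ε = -1)
    (hr : ∀ p ∈ U, 0 < (p.1 - u₀) ^ 2 + k ∧ 0 < (p.2 - v₀) ^ 2 + l)
    (hf : ∀ p ∈ U, f p = √((p.1 - u₀) ^ 2 + k) + ε * √((p.2 - v₀) ^ 2 + l)) :
    IsRadicalSum U f ∨ IsRadicalSum (Prod.swap ⁻¹' U) (f ∘ Prod.swap) := by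
  obtain ⟨a, ha, rfl | rfl⟩ := exists_sq_or_neg_sq hk <;>
    obtain ⟨b, hb, rfl | rfl⟩ := exists_sq_or_neg_sq hl <;>
    try simp only [← sub_eq_add_neg, sub_pos] at hr hf
  · exact Or.inl ⟨a, b, u₀, v₀, ε, ha, hb, hε, Or.inl hf⟩
  · exact Or.inl ⟨a, b, u₀, v₀, ε, ha, hb, hε,
      Or.inr (Or.inr (Or.inl fun p hp => ⟨(hr p hp).2, hf p hp⟩))⟩
  -- Here `k < 0 < l`: with a plus sign this is family (3) after an interchange, with a minus sign
  -- it is family (4).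
  · rcases hε with rfl | rfl
    · refine Or.inr ⟨b, a, v₀, u₀, 1, hb, ha, Or.inl rfl,
        Or.inr (Or.inr (Or.inl fun p hp => ⟨(hr _ hp).1, ?_⟩))⟩
      rw [Function.comp_apply, hf _ hp]
      simp [add_comm]
    · refine Or.inl ⟨a, b, u₀, v₀, 1, ha, hb, Or.inl rfl,
        Or.inr (Or.inr (Or.inr fun p hp => ⟨(hr _ hp).1, ?_⟩))⟩
      rw [hf _ hp]
      ring
  · exact Or.inl ⟨a, b, u₀, v₀, ε, ha, hb, hε,
      Or.inr (Or.inl fun p hp => ⟨(hr p hp).1, (hr p hp).2, hf p hp⟩)⟩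

/-- Neither summand vanishes, so each is a root with a constant sign on `U`. Positivity of `f`
excludes two minus signs, and an interchange puts a positive root first. -/
lemma IsTranslation.isRadicalSum (h : IsTranslation U f φ ψ) (hUc : IsConnected U)
    (hpos : ∀ p ∈ U, 0 < f p) {c u₀ k v₀ l : ℝ} (hk : k ≠ 0) (hl : l ≠ 0)
    (hq : ∀ q ∈ U, φ q.1 - c ≠ 0 ∧ ψ q.2 + c ≠ 0 ∧
      (φ q.1 - c) ^ 2 = (q.1 - u₀) ^ 2 + k ∧ (ψ q.2 + c) ^ 2 = (q.2 - v₀) ^ 2 + l) :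
    IsRadicalSum U f ∨ IsRadicalSum (Prod.swap ⁻¹' U) (f ∘ Prod.swap) := by
  obtain ⟨ε, hε, e1⟩ := eq_mul_sqrt_of_sq_eq hUc.isPreconnected
    (g := fun q : ℝ × ℝ => φ q.1 - c) (r := fun q => (q.1 - u₀) ^ 2 + k)
    ((contDiffOn_comp_fst h.smooth_fst).continuousOn.sub continuousOn_const)
    (by fun_prop) (fun q hqU => (hq q hqU).1) (fun q hqU => (hq q hqU).2.2.1)
  obtain ⟨δ, hδ, e2⟩ := eq_mul_sqrt_of_sq_eq hUc.isPreconnected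
    (g := fun q : ℝ × ℝ => ψ q.2 + c) (r := fun q => (q.2 - v₀) ^ 2 + l)
    ((contDiffOn_comp_snd h.smooth_snd).continuousOn.add continuousOn_const)
    (by fun_prop) (fun q hqU => (hq q hqU).2.1) (fun q hqU => (hq q hqU).2.2.2)
  have hr : ∀ p ∈ U, 0 < (p.1 - u₀) ^ 2 + k ∧ 0 < (p.2 - v₀) ^ 2 + l := by
    intro p hp
    obtain ⟨n1, n2, s1, s2⟩ := hq p hp
    rw [← s1, ← s2]
    exact ⟨by positivity, by positivity⟩
  have hf : ∀ p ∈ U, f p = ε * √((p.1 - u₀) ^ 2 + k) + δ * √((p.2 - v₀) ^ 2 + l) := by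
    intro p hp
    rw [← e1 p hp, ← e2 p hp, h.eq p hp]
    ring
  rcases hε with rfl | rfl
  · exact isRadicalSum_of_eq hk hl hδ hr fun p hp => by rw [hf p hp, one_mul]
  · rcases hδ with rfl | rfl
    · have := isRadicalSum_of_eq (U := Prod.swap ⁻¹' U) (f := f ∘ Prod.swap) (ε := -1)
        hl hk (Or.inr rfl) (fun p hp => (hr _ hp).symm)
        (fun p hp => by rw [Function.comp_apply, hf _ hp]; simp [add_comm])
      exact this.symm
    · obtain ⟨p, hp⟩ := hUc.nonempty
      have h1 := hf p hp
      have h2 := hpos p hp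
      have h3 := Real.sqrt_nonneg ((p.1 - u₀) ^ 2 + k)
      have h4 := Real.sqrt_nonneg ((p.2 - v₀) ^ 2 + l)
      linarith

/-! ### Flaherty graphs -/

lemma exists_eq_const_of_hasDerivAt_zero {I : Set ℝ} (hI : IsOpen I) (hIc : IsConnected I)
    {g : ℝ → ℝ} (hg : ∀ t ∈ I, HasDerivAt g 0 t) : ∃ c, ∀ t ∈ I, g t = c := by
  obtain ⟨s, hs⟩ := hIc.nonempty
  exact ⟨g s, fun t ht => hI.is_const_of_deriv_eq_zero hIc.isPreconnected
    (fun s hs => (hg s hs).differentiableAt.differentiableWithinAt)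
    (fun s hs => (hg s hs).deriv) ht hs⟩

namespace IsTranslation

/-- The sign of `φ' = ±1` is constant on the connected set `I`, and time-likeness becomes `ψ'² > 0`.
-/
lemma isFlaherty (h : IsTranslation U f φ ψ)
    (ht : ∀ p ∈ U, 1 < deriv φ p.1 ^ 2 + deriv ψ p.2 ^ 2) {I J : Set ℝ} (hI : IsOpen I)
    (hIc : IsConnected I) (hJc : IsConnected J) (hIJ : I ×ˢ J ⊆ U)
    (hφ : ∀ u ∈ I, deriv φ u ^ 2 = 1) : IsFlaherty I J f := by
  obtain ⟨u₁, hu₁⟩ := hIc.nonempty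
  obtain ⟨v₁, hv₁⟩ := hJc.nonempty
  have hIU : I ⊆ Prod.fst '' U := fun u hu => ⟨(u, v₁), hIJ ⟨hu, hv₁⟩, rfl⟩
  have hJU : J ⊆ Prod.snd '' U := fun v hv => ⟨(u₁, v), hIJ ⟨hu₁, hv⟩, rfl⟩
  obtain ⟨ε, hε, he⟩ := eq_mul_sqrt_of_sq_eq hIc.isPreconnected (g := deriv φ) (r := fun _ => 1)
    (h.smooth_deriv_fst.continuousOn.mono hIU) continuousOn_const
    (fun u hu h0 => by have := hφ u hu; rw [h0] at this; norm_num at this) hφ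
  simp only [Real.sqrt_one, mul_one] at he
  obtain ⟨c, hc⟩ := exists_eq_const_of_hasDerivAt_zero hI hIc (g := fun u => φ u - ε * u) (by
    intro u hu
    have h1 := h.hasDerivAt_fst (hIJ (Set.mk_mem_prod hu hv₁))
    have h2 := h1.sub ((hasDerivAt_id u).const_mul ε)
    exact h2.congr_deriv (by simp [he u hu]))
  refine ⟨ε, fun v => ψ v + c, hε, (h.smooth_snd.mono hJU).add contDiffOn_const, ?_, ?_⟩
  · intro v hv h0
    have h1 := ht _ (hIJ (Set.mk_mem_prod hu₁ hv))
    rw [deriv_add_const] at h0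
    simp only [h0, hφ u₁ hu₁] at h1
    norm_num at h1
  · intro u hu v hv
    rw [h.eq _ (hIJ (Set.mk_mem_prod hu hv))]
    have := hc u hu
    simp only at this ⊢
    linarith

lemma swap_timelike
    (ht : ∀ p ∈ U, 1 < deriv φ p.1 ^ 2 + deriv ψ p.2 ^ 2) :
    ∀ p ∈ Prod.swap ⁻¹' U, 1 < deriv ψ p.1 ^ 2 + deriv φ p.2 ^ 2 := by
  intro p hp
  rw [add_comm]
  exact ht _ hp

lemma isFlaherty_swap (h : IsTranslation U f φ ψ)
    (ht : ∀ p ∈ U, 1 < deriv φ p.1 ^ 2 + deriv ψ p.2 ^ 2) {I J : Set ℝ} (hJ : IsOpen J)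
    (hIc : IsConnected I) (hJc : IsConnected J) (hIJ : I ×ˢ J ⊆ U)
    (hψ : ∀ v ∈ J, deriv ψ v ^ 2 = 1) : IsFlaherty J I (f ∘ Prod.swap) :=
  h.swap.isFlaherty (swap_timelike ht) hJ hJc hIc (fun _ hp => hIJ ⟨hp.2, hp.1⟩) hψ

/-- If the slopes at one point are both different from `±1`, and `φ'' ≠ 0` forces `ψ' = ±1` and
vice versa, the graph is a plane. -/
lemma eq_affine (h : IsTranslation U f φ ψ) (hUc : IsPreconnected U)
    (hφ : ∀ p ∈ U, deriv (deriv φ) p.1 ≠ 0 → deriv ψ p.2 ^ 2 = 1)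
    (hψ : ∀ p ∈ U, deriv (deriv ψ) p.2 ≠ 0 → deriv φ p.1 ^ 2 = 1)
    {p : ℝ × ℝ} (hp : p ∈ U) (hp1 : deriv φ p.1 ^ 2 ≠ 1) (hp2 : deriv ψ p.2 ^ 2 ≠ 1) :
    ∃ α β γ : ℝ, ∀ q ∈ U, f q = α * q.1 + β * q.2 + γ := by
  set S : Set (ℝ × ℝ) := {q | q ∈ U ∧ deriv φ q.1 = deriv φ p.1 ∧ deriv ψ q.2 = deriv ψ p.2}
    with hS
  -- Near a point of `S` both slopes stay away from `±1`, which forces both second derivatives to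
  -- vanish, so the slopes are locally constant.
  have hSo : IsOpen S := by
    rw [isOpen_iff_mem_nhds]
    rintro q ⟨hq, q1, q2⟩
    obtain ⟨-, c1, -⟩ := h.continuousAt hq
    obtain ⟨-, d1, -⟩ := h.continuousAt' hq
    have n1 : ∀ᶠ r in 𝓝 q, deriv φ r.1 ^ 2 ≠ 1 := (c1.pow 2).eventually_ne
      (by change deriv φ q.1 ^ 2 ≠ 1; rwa [q1])
    have n2 : ∀ᶠ r in 𝓝 q, deriv ψ r.2 ^ 2 ≠ 1 := (d1.pow 2).eventually_ne
      (by change deriv ψ q.2 ^ 2 ≠ 1; rwa [q2])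
    have m1 : ∀ᶠ u in 𝓝 q.1, deriv φ u = deriv φ q.1 := by
      apply eventually_eq_of_deriv_eq_zero
      apply eventually_of_eventually_fst (P := fun u => HasDerivAt (deriv φ) 0 u)
      filter_upwards [h.isOpen.mem_nhds hq, n2] with r hr hr2
      have h0 : deriv (deriv φ) r.1 = 0 := by
        by_contra h0
        exact hr2 (hφ r hr h0)
      simpa [h0] using h.hasDerivAt_deriv_fst hr
    have m2 : ∀ᶠ v in 𝓝 q.2, deriv ψ v = deriv ψ q.2 := by
      apply eventually_eq_of_deriv_eq_zero
      apply eventually_of_eventually_snd (P := fun v => HasDerivAt (deriv ψ) 0 v)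
      filter_upwards [h.isOpen.mem_nhds hq, n1] with r hr hr1
      have h0 : deriv (deriv ψ) r.2 = 0 := by
        by_contra h0
        exact hr1 (hψ r hr h0)
      simpa [h0] using h.hasDerivAt_deriv_snd hr
    filter_upwards [h.isOpen.mem_nhds hq, (continuous_fst.tendsto q).eventually m1,
      (continuous_snd.tendsto q).eventually m2] with r hr r1 r2
    exact ⟨hr, r1.trans q1, r2.trans q2⟩
  have hScl : closure S ∩ U ⊆ S := by
    rintro w ⟨hw, hwU⟩
    have e1 := eq_of_mem_closure (c := deriv φ p.1) hw (h.continuousAt hwU).2.1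
      fun z hz => hz.2.1
    have e2 := eq_of_mem_closure (c := deriv ψ p.2) hw (h.continuousAt' hwU).2.1
      fun z hz => hz.2.2
    exact ⟨hwU, e1, e2⟩
  have hsub : U ⊆ S := hUc.subset_of_closure_inter_subset hSo ⟨p, hp, hp, rfl, rfl⟩ hScl
  have hd : ∀ q ∈ U, HasFDerivAt (fun q : ℝ × ℝ => f q - (deriv φ p.1 * q.1 + deriv ψ p.2 * q.2))
      (0 : ℝ × ℝ →L[ℝ] ℝ) q := by
    intro q hq
    obtain ⟨-, q1, q2⟩ := hsub hq
    have e1 := h.hasFDerivAt hq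
    rw [q1, q2] at e1
    have e2 := e1.sub (deriv φ p.1 • ContinuousLinearMap.fst ℝ ℝ ℝ +
      deriv ψ p.2 • ContinuousLinearMap.snd ℝ ℝ ℝ).hasFDerivAt
    rw [sub_self] at e2
    exact e2
  refine ⟨deriv φ p.1, deriv ψ p.2, f p - (deriv φ p.1 * p.1 + deriv ψ p.2 * p.2), ?_⟩
  intro q hq
  have := h.isOpen.is_const_of_fderiv_eq_zero (𝕜 := ℝ) hUc
    (fun r hr => (hd r hr).differentiableAt.differentiableWithinAt)
    (fun r hr => (hd r hr).fderiv) hq hp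
  linarith

lemma isFlaherty_or (h : IsTranslation U f φ ψ) (hUc : IsPreconnected U)
    (ht : ∀ p ∈ U, 1 < deriv φ p.1 ^ 2 + deriv ψ p.2 ^ 2)
    (hnontriv : ¬ ∃ α β γ : ℝ, ∀ p ∈ U, f p = α * p.1 + β * p.2 + γ)
    (hE : ∀ p ∈ U, conformalDefect f φ ψ p = 0 ∨
      (deriv (deriv φ) p.1 = 0 ∧ deriv (deriv ψ) p.2 = 0))
    (hprod : ∀ p ∈ U, deriv (deriv φ) p.1 = 0 ∨ deriv (deriv ψ) p.2 = 0)
    {I J : Set ℝ} (hI : IsOpen I) (hJ : IsOpen J) (hIc : IsConnected I) (hJc : IsConnected J)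
    (hIJ : I ×ˢ J ⊆ U) : IsFlaherty I J f ∨ IsFlaherty J I (f ∘ Prod.swap) := by
  have hφ : ∀ p ∈ U, deriv (deriv φ) p.1 ≠ 0 → deriv ψ p.2 ^ 2 = 1 := by
    intro p hp h0
    have h1 := (hprod p hp).resolve_left h0
    have h2 := (hE p hp).resolve_right fun h3 => h0 h3.1
    simp only [conformalDefect, h1] at h2
    apply mul_left_cancel₀ h0
    linear_combination h2
  have hψ : ∀ p ∈ U, deriv (deriv ψ) p.2 ≠ 0 → deriv φ p.1 ^ 2 = 1 := by
    intro p hp h0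
    have h1 := (hprod p hp).resolve_right h0
    have h2 := (hE p hp).resolve_right fun h3 => h0 h3.2
    simp only [conformalDefect, h1] at h2
    apply mul_left_cancel₀ h0
    linear_combination h2
  -- One such `v` is enough: its horizontal line meets the rectangle over every `u ∈ I`, so `φ'² =
  -- 1` on all of `I`.
  by_cases hex : ∃ v ∈ J, deriv (deriv ψ) v ≠ 0
  · obtain ⟨v, hv, h0⟩ := hex
    exact Or.inl (h.isFlaherty ht hI hIc hJc hIJ
      fun u hu => hψ (u, v) (hIJ ⟨hu, hv⟩) h0)
  by_cases hex' : ∃ u ∈ I, deriv (deriv φ) u ≠ 0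
  · obtain ⟨u, hu, h0⟩ := hex'
    exact Or.inr (h.isFlaherty_swap ht hJ hIc hJc hIJ
      fun v hv => hφ (u, v) (hIJ ⟨hu, hv⟩) h0)
  push Not at hex hex'
  obtain ⟨u₁, hu₁⟩ := hIc.nonempty
  obtain ⟨v₁, hv₁⟩ := hJc.nonempty
  obtain ⟨α, hα⟩ := exists_eq_const_of_hasDerivAt_zero hI hIc (g := deriv φ) fun u hu => by
    have := h.hasDerivAt_deriv_fst (hIJ (Set.mk_mem_prod hu hv₁))
    simpa [hex' u hu] using this
  obtain ⟨β, hβ⟩ := exists_eq_const_of_hasDerivAt_zero hJ hJc (g := deriv ψ) fun v hv => by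
    have := h.hasDerivAt_deriv_snd (hIJ (Set.mk_mem_prod hu₁ hv))
    simpa [hex v hv] using this
  by_cases hα1 : α ^ 2 = 1
  · exact Or.inl (h.isFlaherty ht hI hIc hJc hIJ fun u hu => by rw [hα u hu, hα1])
  by_cases hβ1 : β ^ 2 = 1
  · exact Or.inr (h.isFlaherty_swap ht hJ hIc hJc hIJ fun v hv => by rw [hβ v hv, hβ1])
  exact absurd (h.eq_affine hUc hφ hψ (hIJ (Set.mk_mem_prod hu₁ hv₁))
    (by dsimp only; rwa [hα u₁ hu₁]) (by dsimp only; rwa [hβ v₁ hv₁])) hnontriv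

end IsTranslation

/-! ### Sufficiency -/

/-- All radical families at once: each signed root solves `y y'' + y'² = 1`, and `E` is a
combination of the two equations (`c = 0`). -/
lemma conformal_of_eq_sqrt (hUo : IsOpen U) (hf : ContDiffOn ℝ ∞ f U) (hpos : ∀ p ∈ U, 0 < f p)
    (htime : IsTimelike U (graph f)) {u₀ k v₀ l ε δ : ℝ} (hε : ε = 1 ∨ ε = -1)
    (hδ : δ = 1 ∨ δ = -1) (hr : ∀ p ∈ U, 0 < (p.1 - u₀) ^ 2 + k ∧ 0 < (p.2 - v₀) ^ 2 + l)
    (he : ∀ p ∈ U, f p = ε * √((p.1 - u₀) ^ 2 + k) + δ * √((p.2 - v₀) ^ 2 + l)) :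
    HasConformalNormalGaussMap U (graph f) := by
  have h : IsTranslation U f (fun u => ε * √((u - u₀) ^ 2 + k))
      (fun v => δ * √((v - v₀) ^ 2 + l)) := .of_contDiffOn hUo hf he
  refine h.conformal_of_defect hpos ((h.isTimelike_iff hpos).1 htime) fun p hp => ?_
  have hε2 : ε ^ 2 = 1 := by rcases hε with rfl | rfl <;> norm_num
  have hδ2 : δ ^ 2 = 1 := by rcases hδ with rfl | rfl <;> norm_num
  have o1 := ode_of_sq_eq (u₀ := u₀) (k := k) (h.eventually_hasDerivAt_fst hp)
    (h.hasDerivAt_deriv_fst hp) (by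
      apply eventually_of_eventually_fst
        (P := fun t => (ε * √((t - u₀) ^ 2 + k)) ^ 2 = (t - u₀) ^ 2 + k)
      filter_upwards [hUo.mem_nhds hp] with q hq
      rw [mul_pow, hε2, Real.sq_sqrt (hr q hq).1.le, one_mul])
  have o2 := ode_of_sq_eq (u₀ := v₀) (k := l) (h.swap.eventually_hasDerivAt_fst (p := p.swap) hp)
    (h.hasDerivAt_deriv_snd hp) (by
      apply eventually_of_eventually_snd
        (P := fun t => (δ * √((t - v₀) ^ 2 + l)) ^ 2 = (t - v₀) ^ 2 + l)
      filter_upwards [hUo.mem_nhds hp] with q hq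
      rw [mul_pow, hδ2, Real.sq_sqrt (hr q hq).2.le, one_mul])
  simp only [Prod.fst_swap] at o2
  simp only [conformalDefect, h.eq p hp]
  linear_combination deriv (deriv fun v => δ * √((v - v₀) ^ 2 + l)) p.2 * o1 +
    deriv (deriv fun u => ε * √((u - u₀) ^ 2 + k)) p.1 * o2

lemma IsRadicalSum.exists_eq (h : IsRadicalSum U f) : ∃ u₀ k v₀ l ε δ : ℝ, (ε = 1 ∨ ε = -1) ∧
    (δ = 1 ∨ δ = -1) ∧ (∀ p ∈ U, 0 < (p.1 - u₀) ^ 2 + k ∧ 0 < (p.2 - v₀) ^ 2 + l) ∧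
    ∀ p ∈ U, f p = ε * √((p.1 - u₀) ^ 2 + k) + δ * √((p.2 - v₀) ^ 2 + l) := by
  obtain ⟨a, b, u₀, v₀, ε, ha, hb, hε, h | h | h | h⟩ := h
  · refine ⟨u₀, a ^ 2, v₀, b ^ 2, 1, ε, Or.inl rfl, hε, fun p _ => ⟨by positivity, by positivity⟩,
      fun p hp => by rw [h p hp, one_mul]⟩
  · refine ⟨u₀, -a ^ 2, v₀, -b ^ 2, 1, ε, Or.inl rfl, hε,
      fun p hp => ⟨by linarith [(h p hp).1], by linarith [(h p hp).2.1]⟩,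
      fun p hp => by rw [(h p hp).2.2, one_mul, ← sub_eq_add_neg, ← sub_eq_add_neg]⟩
  · refine ⟨u₀, a ^ 2, v₀, -b ^ 2, 1, ε, Or.inl rfl, hε,
      fun p hp => ⟨by positivity, by linarith [(h p hp).1]⟩,
      fun p hp => by rw [(h p hp).2, one_mul, ← sub_eq_add_neg]⟩
  · refine ⟨u₀, -a ^ 2, v₀, b ^ 2, 1, -1, Or.inl rfl, Or.inr rfl,
      fun p hp => ⟨by linarith [(h p hp).1], by positivity⟩,
      fun p hp => by rw [(h p hp).2, one_mul, neg_one_mul, ← sub_eq_add_neg, ← sub_eq_add_neg]⟩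

namespace IsTranslation

lemma defect_eq_zero_of_isFlaherty (h : IsTranslation U f φ ψ) {I J : Set ℝ} (hI : IsOpen I)
    (hIJ : I ×ˢ J ⊆ U) (hF : IsFlaherty I J f) {p : ℝ × ℝ} (hp : p ∈ I ×ˢ J) :
    conformalDefect f φ ψ p = 0 := by
  obtain ⟨ε, χ, hε, -, -, hf⟩ := hF
  have h1 : ∀ u ∈ I, deriv φ u = ε := by
    intro u hu
    have : φ =ᶠ[𝓝 u] fun t => ε * t + (χ p.2 - ψ p.2) := by
      filter_upwards [hI.mem_nhds hu] with t ht
      have e1 := hf t ht p.2 hp.2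
      rw [h.eq _ (hIJ (Set.mk_mem_prod ht hp.2))] at e1
      simp only at e1
      linarith
    rw [this.deriv_eq]
    simp
  have h2 : deriv (deriv φ) p.1 = 0 :=
    deriv_eq_zero_of_eventually ((hI.eventually_mem hp.1).mono h1)
  have hε2 : ε ^ 2 = 1 := by rcases hε with rfl | rfl <;> norm_num
  simp [conformalDefect, h2, h1 p.1 hp.1, hε2]

end IsTranslation

end DeSitter

/-! ### The classification. -/

theorem theorem7p3 (U : Set (ℝ × ℝ)) (hUo : IsOpen U) (hUc : IsConnected U)
    (f : ℝ × ℝ → ℝ) (hf : ContDiffOn ℝ ∞ f U) (hpos : ∀ p ∈ U, 0 < f p)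
    (htime : DeSitter.IsTimelike U (DeSitter.graph f))
    (htrans : ∃ φ ψ : ℝ → ℝ, ∀ p ∈ U, f p = φ p.1 + ψ p.2)
    (hnontriv : ¬ ∃ α β γ : ℝ, ∀ p ∈ U, f p = α * p.1 + β * p.2 + γ) :
    DeSitter.HasConformalNormalGaussMap U (DeSitter.graph f) ↔
      (DeSitter.IsRadicalSum U f ∨
        DeSitter.IsRadicalSum (Prod.swap ⁻¹' U) (f ∘ Prod.swap)) ∨
      ∀ I J : Set ℝ, IsOpen I → IsOpen J → IsConnected I → IsConnected J → I ×ˢ J ⊆ U →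
        (DeSitter.IsFlaherty I J f ∨ DeSitter.IsFlaherty J I (f ∘ Prod.swap)) := by
  obtain ⟨φ, ψ, hφψ⟩ := htrans
  have h := DeSitter.IsTranslation.of_contDiffOn hUo hf hφψ
  have ht := (h.isTimelike_iff hpos).1 htime
  constructor
  · intro hc
    have hE := fun p hp => h.defect_eq_zero_or hpos ht hc (p := p) hp
    by_cases hex : ∃ p ∈ U, deriv (deriv φ) p.1 ≠ 0 ∧ deriv (deriv ψ) p.2 ≠ 0
    · obtain ⟨p, hp, h1, h2⟩ := hex
      obtain ⟨c, u₀, k, v₀, l, hk, hl, hq⟩ := h.exists_sq_eq hUc.isPreconnected hE hp h1 h2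
      exact Or.inl (h.isRadicalSum hUc hpos hk hl hq)
    · have hprod : ∀ p ∈ U, deriv (deriv φ) p.1 = 0 ∨ deriv (deriv ψ) p.2 = 0 := by
        intro p hp
        by_contra! h0
        exact hex ⟨p, hp, h0⟩
      exact Or.inr fun I J hI hJ hIc hJc hIJ =>
        h.isFlaherty_or hUc.isPreconnected ht hnontriv hE hprod hI hJ hIc hJc hIJ
  · rintro ((hR | hR) | hF)
    · obtain ⟨u₀, k, v₀, l, ε, δ, hε, hδ, hr, he⟩ := hR.exists_eq
      exact DeSitter.conformal_of_eq_sqrt hUo hf hpos htime hε hδ hr he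
    · obtain ⟨u₀, k, v₀, l, ε, δ, hε, hδ, hr, he⟩ := hR.exists_eq
      exact DeSitter.conformal_of_eq_sqrt hUo hf hpos htime hδ hε
        (fun p hp => (hr p.swap (by simpa using hp)).symm)
        (fun p hp => by simpa [add_comm] using he p.swap (by simpa using hp))
    · refine h.conformal_of_defect hpos ht fun p hp => ?_
      -- Balls of the sup metric are open rectangles, so the Flaherty condition applies around every
      -- point, and `E = 0` is a pointwise condition.
      obtain ⟨r, hr, hb⟩ := Metric.isOpen_iff.1 hUo p hp
      rw [← ball_prod_same] at hb
      have hc : ∀ x : ℝ, IsConnected (Metric.ball x r) := fun x =>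
        ⟨⟨x, Metric.mem_ball_self hr⟩, (convex_ball x r).isPreconnected⟩
      have hpm : p ∈ Metric.ball p.1 r ×ˢ Metric.ball p.2 r :=
        ⟨Metric.mem_ball_self hr, Metric.mem_ball_self hr⟩
      rcases hF _ _ Metric.isOpen_ball Metric.isOpen_ball (hc _) (hc _) hb with h1 | h1
      · exact h.defect_eq_zero_of_isFlaherty Metric.isOpen_ball hb h1 hpm
      · have := h.swap.defect_eq_zero_of_isFlaherty Metric.isOpen_ball
          (fun q hq => hb ⟨hq.2, hq.1⟩) h1 (p := p.swap) ⟨hpm.2, hpm.1⟩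
        rw [DeSitter.IsTranslation.defect_swap] at this
        exact this
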